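/- Let $(A,\mathfrak m)$ be a Cohen--Macaulay (Noetherian) local ring of dimension $d$, and let $\operatorname{CM}(A)$ be the category of maximal Cohen--Macaulay (MCM) $A$-modules, i.e. of finitely generated $A$-modules that are zero or of depth $d$, with all $A$-linear maps. For $M\in\operatorname{CM}(A)$ put $$e^T(M)=\lim_{n\to\infty}\frac{(d-1)!}{n^{d-1}}\,\ell\big(\operatorname{Tor}_1^A(M,A/\mathfrak m^{n+1})\big)$$ (if $d=0$, the factor $(d-1)!/n^{d-1}$ is read as $1$; then $\operatorname{Tor}_1^A(M,A/\mathfrak m^{n+1})=0$ for $n\gg0$ and $e^T(M)=0$). For a short exact sequence $s\colon 0\to N\to E\to M\to 0$ with $M,N\in\operatorname{CM}(A)$ put $e^T(s)=e^T(M)+e^T(N)-e^T(E)$, and let $T_A(M,N)\subseteq\operatorname{Ext}^1_A(M,N)$ be the set of classes of such sequences $s$ with $e^T(s)=0$. Then: 1. For every $M\in\operatorname{CM}(A)$ the lengths above are finite and the limit $e^T(M)$ exists in $\mathbb R$. 2. For every short exact sequence $s\colon 0\to N\to E\to M\to0$ with $M,N\in\operatorname{CM}(A)$ the module $E$ is MCM,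 and the class of $s$ lies in $T_A(M,N)$ if and only if $e^T(s)=0$; thus the condition $e^T(s)=0$ depends only on the class of $s$. 3. For all $M,N\in\operatorname{CM}(A)$, $T_A(M,N)$ is an $A$-submodule of $\operatorname{Ext}^1_A(M,N)$. 4. $T_A$ is a subfunctor of $\operatorname{Ext}^1_A(-,-)\colon \operatorname{CM}(A)^{\mathrm{op}}\times\operatorname{CM}(A)\to\operatorname{mod}(A)$, where $\operatorname{mod}(A)$ is the category of finitely generated $A$-modules: there are a functor $T\colon \operatorname{CM}(A)^{\mathrm{op}}\times\operatorname{CM}(A)\to\operatorname{mod}(A)$ and a natural transformation $T\to\operatorname{Ext}^1_A(-,-)$ all of whose components are injective, with image $T_A(M,N)$ at $(M,N)$. -/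

import Mathlib

open CategoryTheory CategoryTheory.Abelian

universe u

noncomputable section

namespace TorSplit

/-- A maximal Cohen–Macaulay module over a local ring `A`: a finitely generated module which is
zero or admits a regular sequence of length `dim A` inside the maximal ideal, i.e. has depth
`dim A`. (The zero module, of depth `∞`, is included.) -/
def IsMCM (A : Type u) [CommRing A] [IsLocalRing A]
    (M : Type u) [AddCommGroup M] [Module A M] : Prop :=
  Module.Finite A M ∧ (Subsingleton M ∨
    ∃ rs : List A, (∀ r ∈ rs, r ∈ IsLocalRing.maximalIdeal A) ∧
      (rs.length : WithBot ℕ∞) = ringKrullDim A ∧ RingTheory.Sequence.IsRegular M rs)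

/-- A Cohen–Macaulay local ring: Noetherian, local, and of depth `dim A` over itself. -/
class IsCohenMacaulayLocal (A : Type u) [CommRing A] : Prop extends
    IsNoetherianRing A, IsLocalRing A where
  isMCM_self : IsMCM A A

/-- The property of being maximal Cohen–Macaulay, on the category of `A`-modules. -/
def mcmProperty (A : Type u) [CommRing A] [IsLocalRing A] :
    ObjectProperty (ModuleCat.{u} A) :=
  fun M => IsMCM A M

/-- The category `CM(A)` of maximal Cohen–Macaulay modules with all `A`-linear maps. -/
abbrev CM (A : Type u) [CommRing A] [IsLocalRing A] := (mcmProperty A).FullSubcategory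

/-- The `A`-module `Tor₁(M, A/𝔪ⁿ⁺¹)`. (`Tor'` is the left derived functor of the tensor product
in the first variable.) -/
abbrev torOne (A : Type u) [CommRing A] [IsLocalRing A] (M : ModuleCat.{u} A) (n : ℕ) :
    ModuleCat.{u} A :=
  ((Tor' (ModuleCat.{u} A) 1).obj M).obj
    (ModuleCat.of A (A ⧸ IsLocalRing.maximalIdeal A ^ (n + 1)))

/-- The Krull dimension as a natural number (it is finite for Noetherian local rings). -/
def dim (A : Type u) [CommRing A] : ℕ := ((ringKrullDim A).unbotD 0).toNat

/-- The sequence `(d-1)! / n^(d-1) * ℓ(Tor₁(M, A/𝔪ⁿ⁺¹))`, where `d = dim A`. For `d = 0` the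
factor is `1`; then `Tor₁(M, A/𝔪ⁿ⁺¹) = 0` for large `n`, so the limit is `0` in any
normalization. -/
def eTSeq (A : Type u) [CommRing A] [IsLocalRing A] (M : ModuleCat.{u} A) (n : ℕ) : ℝ :=
  ((dim A - 1).factorial : ℝ) / (n : ℝ) ^ (dim A - 1) *
    ((Module.length A (torOne A M n)).toNat : ℝ)

/-- `e^T(M)`, the limit of `eTSeq A M`. -/
def eT (A : Type u) [CommRing A] [IsLocalRing A] (M : ModuleCat.{u} A) : ℝ :=
  Filter.limUnder Filter.atTop (eTSeq A M)

/-- `e^T(s) = e^T(M) + e^T(N) - e^T(E)` for `s : N ⟶ E ⟶ M`. -/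
def eTDefect (A : Type u) [CommRing A] [IsLocalRing A]
    (S : ShortComplex (ModuleCat.{u} A)) : ℝ :=
  eT A S.X₃ + eT A S.X₁ - eT A S.X₂

/-- `T_A(M, N)`, the set of classes in `Ext¹(M, N)` of extensions `0 ⟶ N ⟶ E ⟶ M ⟶ 0` with
`e^T = 0`. -/
def tSplit (A : Type u) [CommRing A] [IsLocalRing A] (M N : ModuleCat.{u} A) :
    Set (Ext.{u} M N 1) :=
  {α | ∃ (E : ModuleCat.{u} A) (i : N ⟶ E) (p : E ⟶ M) (w : i ≫ p = 0)
    (hS : (ShortComplex.mk i p w).ShortExact),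
    hS.extClass = α ∧ eTDefect A (ShortComplex.mk i p w) = 0}

lemma finite_ext (A : Type u) [CommRing A] [IsLocalRing A] [IsNoetherianRing A] (M N : CM A) :
    Module.Finite A (Ext.{u} M.obj N.obj 1) := by
  have : Module.Finite A M.obj := M.property.1
  have : Module.Finite A N.obj := N.property.1
  infer_instance

/-- The bifunctor `Ext¹ : CM(A)ᵒᵖ × CM(A) ⥤ mod(A)` (curried). A map `f : N ⟶ N'` acts by
postcomposition and a map `g : M' ⟶ M` by precomposition. -/
def extOne (A : Type u) [CommRing A] [IsLocalRing A] [IsNoetherianRing A] :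
    (CM A)ᵒᵖ ⥤ CM A ⥤ FGModuleCat.{u} A where
  obj M :=
    { obj N := ⟨ModuleCat.of A (Ext.{u} M.unop.obj N.obj 1), finite_ext A M.unop N⟩
      map f := ObjectProperty.homMk
        (ModuleCat.ofHom ((Ext.mk₀ f.hom).postcompOfLinear A M.unop.obj (add_zero 1)))
      map_id N := by
        apply FGModuleCat.hom_ext
        ext α
        simp
      map_comp f g := by
        apply FGModuleCat.hom_ext
        ext α
        simp [← Ext.mk₀_comp_mk₀, Ext.comp_assoc_of_second_deg_zero] }
  map g :=
    { app N := ObjectProperty.homMk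
        (ModuleCat.ofHom ((Ext.mk₀ g.unop.hom).precompOfLinear A N.obj (zero_add 1)))
      naturality N N' f := by
        apply FGModuleCat.hom_ext
        ext α
        simp [Ext.comp_assoc_of_third_deg_zero] }
  map_id M := by
    ext N
    simp
  map_comp g h := by
    ext N
    simp

end TorSplit

end

/-! The theorem rests on three properties of `e^T`: the limit exists, it is subadditive on short
exact sequences (`eT_le_add`), and it is additive on direct sums (`eT_prod`).

Existence: a presentation 0 → K → F → M → 0 with F finite free gives ℓ(Tor₁(M, A/𝔪ⁿ)) = ℓ(K/𝔪ⁿK) −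
ℓ(F/𝔪ⁿF) + ℓ(M/𝔪ⁿM), which for large n is a polynomial of degree at most d = dim A by Hilbert–Samuel
(`eventuallyPoly_hs`). Artin–Rees bounds it, up to a shift of n, by an increment of the
Hilbert–Samuel function of K, so the degree is less than d (`eventuallyPoly_len_torOne`) and
division by n^(d-1) gives a convergent sequence.

Subfunctor: subadditivity says e^T(s) ≥ 0. A pushout of s along N → N' yields an exact sequence 0 →
N → N' ⊕ E → E' → 0, and a pullback along M' → M yields 0 → E' → E ⊕ M' → M → 0. Subadditivity of
these says that e^T(s) cannot increase, so the value 0 is preserved. This gives functoriality,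
stability under scalars, and independence of the representative. For sums, E ×_M E' is an extension
of M by N ⊕ N; being the kernel of E ⊕ E' → M, it has defect 0 when s and s' do, and its pushout
along addition N ⊕ N → N is the Baer sum. -/

noncomputable section

namespace TorSplit

open Filter fwdDiff TensorProduct

open IsLocalRing (maximalIdeal)

/-! ### Eventually polynomial functions -/

/-- `f` agrees eventually with a polynomial of degree less than `k`, expressed by the vanishing of
the `k`-th iterated difference. -/
def EventuallyPoly (k : ℕ) (f : ℕ → ℝ) : Prop :=
  ∀ᶠ n in atTop, (Δ_[1])^[k] f n = 0

namespace EventuallyPoly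

variable {k : ℕ} {f g : ℕ → ℝ}

lemma fwdDiff_eventuallyEq (h : f =ᶠ[atTop] g) : Δ_[1] f =ᶠ[atTop] Δ_[1] g := by
  filter_upwards [h, (tendsto_add_atTop_nat 1).eventually h] with n h₁ h₂
  simp [fwdDiff, h₁, h₂]

lemma iterate_eventuallyEq (k : ℕ) (h : f =ᶠ[atTop] g) :
    (Δ_[1])^[k] f =ᶠ[atTop] (Δ_[1])^[k] g := by
  induction k with
  | zero => exact h
  | succ k ih =>
    rw [Function.iterate_succ_apply', Function.iterate_succ_apply']
    exact fwdDiff_eventuallyEq ih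

lemma congr (hf : EventuallyPoly k f) (h : f =ᶠ[atTop] g) : EventuallyPoly k g := by
  filter_upwards [hf, iterate_eventuallyEq k h] with n h₁ h₂
  rw [← h₂, h₁]

lemma of_fwdDiff (h : EventuallyPoly k (Δ_[1] f)) : EventuallyPoly (k + 1) f := h

lemma succ (h : EventuallyPoly k f) : EventuallyPoly (k + 1) f := by
  filter_upwards [h, (tendsto_add_atTop_nat 1).eventually h] with n h₁ h₂
  rw [Function.iterate_succ_apply', fwdDiff, h₁, h₂, sub_zero]

lemma mono (h : EventuallyPoly k f) {l : ℕ} (hkl : k ≤ l) : EventuallyPoly l f := by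
  induction l, hkl using Nat.le_induction with
  | base => exact h
  | succ l _ ih => exact ih.succ

lemma add (hf : EventuallyPoly k f) (hg : EventuallyPoly k g) : EventuallyPoly k (f + g) := by
  filter_upwards [hf, hg] with n h₁ h₂
  rw [fwdDiff_iter_add, Pi.add_apply, h₁, h₂, add_zero]

lemma neg (hf : EventuallyPoly k f) : EventuallyPoly k (-f) := by
  filter_upwards [hf] with n h₁
  rw [← neg_one_smul ℝ f, fwdDiff_iter_const_smul, Pi.smul_apply, h₁, smul_zero]

lemma sub (hf : EventuallyPoly k f) (hg : EventuallyPoly k g) : EventuallyPoly k (f - g) := by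
  rw [sub_eq_add_neg]
  exact hf.add hg.neg

lemma comp_add (hf : EventuallyPoly k f) (c : ℕ) : EventuallyPoly k (fun n => f (n + c)) := by
  filter_upwards [(tendsto_add_atTop_nat c).eventually hf] with n h
  rw [fwdDiff_iter_comp_add, h]

lemma fwdDiff (hf : EventuallyPoly (k + 1) f) : EventuallyPoly k (Δ_[1] f) := hf

/-- The increments `f (n + c) - f n` have lower degree. -/
lemma comp_add_sub (hf : EventuallyPoly (k + 1) f) (c : ℕ) :
    EventuallyPoly k (fun n => f (n + c) - f n) := by
  induction c with
  | zero =>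
    refine EventuallyPoly.mono (k := 0) ?_ (Nat.zero_le k)
    simp [EventuallyPoly]
  | succ c ih =>
    refine (ih.add (hf.fwdDiff.comp_add c)).congr (Eventually.of_forall fun n => ?_)
    simp [_root_.fwdDiff, add_assoc]

/-- Newton's forward difference formula based at a point `N` beyond which the `k`-th difference
vanishes: the terms with `j ≥ k` drop out, and `n.choose j` is polynomial in `n` of degree `j`. -/
lemma exists_polynomial (hf : EventuallyPoly k f) :
    ∃ p : Polynomial ℝ, p.degree < k ∧ ∀ᶠ n : ℕ in atTop, f n = p.eval (n : ℝ) := by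
  obtain ⟨N, hN⟩ := eventually_atTop.1 hf
  have hN' : ∀ j, k ≤ j → (Δ_[1])^[j] f N = 0 := by
    intro j hj
    suffices ∀ n ≥ N, (Δ_[1])^[j] f n = 0 from this N le_rfl
    induction j, hj using Nat.le_induction with
    | base => exact hN
    | succ j _ ih =>
      intro n hn
      rw [Function.iterate_succ_apply', _root_.fwdDiff, ih n hn, ih (n + 1) (by omega), sub_zero]
  let q : Polynomial ℝ := ∑ j ∈ Finset.range k,
    Polynomial.C ((Δ_[1])^[j] f N / j.factorial) * descPochhammer ℝ j
  have hq : ∀ n : ℕ, f (N + n) = q.eval (n : ℝ) := by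
    intro n
    have h := shift_eq_sum_fwdDiff_iter 1 f n N
    rw [smul_eq_mul, mul_one] at h
    rw [h, Polynomial.eval_finsetSum]
    have e : ∀ j, (n.choose j) • (Δ_[1])^[j] f N =
        (Polynomial.C ((Δ_[1])^[j] f N / j.factorial) * descPochhammer ℝ j).eval (n : ℝ) := by
      intro j
      rw [Polynomial.eval_mul, Polynomial.eval_C, descPochhammer_eval_eq_descFactorial,
        nsmul_eq_mul, Nat.descFactorial_eq_factorial_mul_choose]
      have : (j.factorial : ℝ) ≠ 0 := by positivity
      push_cast
      field_simp
    rw [Finset.sum_congr rfl fun j _ => e j]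
    rcases le_total (n + 1) k with hnk | hnk
    · refine Finset.sum_subset (Finset.range_mono hnk) fun j _ hj => ?_
      rw [← e j, Nat.choose_eq_zero_of_lt (by simpa using hj), zero_smul]
    · refine (Finset.sum_subset (Finset.range_mono hnk) fun j _ hj => ?_).symm
      rw [← e j, hN' j (by simpa using hj), smul_zero]
  refine ⟨q.comp (Polynomial.X - Polynomial.C (N : ℝ)), ?_, ?_⟩
  · have hd : q.degree < k := by
      refine (Polynomial.degree_sum_le _ _).trans_lt ?_
      refine (Finset.sup_lt_iff (WithBot.bot_lt_coe k)).2 fun j hj => ?_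
      refine Polynomial.degree_le_natDegree.trans_lt ?_
      have h := Polynomial.natDegree_C_mul_le ((Δ_[1])^[j] f N / j.factorial) (descPochhammer ℝ j)
      rw [descPochhammer_natDegree] at h
      exact WithBot.coe_lt_coe.2 (h.trans_lt (Finset.mem_range.1 hj))
    rcases eq_or_ne q 0 with h0 | h0
    · simp [h0]
    · have h1 : q.natDegree < k := (Polynomial.natDegree_lt_iff_degree_lt h0).2 hd
      refine (Polynomial.degree_le_natDegree).trans_lt ?_
      rw [Polynomial.natDegree_comp, Polynomial.natDegree_X_sub_C, mul_one]
      exact_mod_cast h1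
  · filter_upwards [eventually_ge_atTop N] with n hn
    obtain ⟨m, rfl⟩ := Nat.exists_eq_add_of_le hn
    simp [hq]

end EventuallyPoly

lemma eventuallyPoly_eval {k : ℕ} {p : Polynomial ℝ} (hp : p.degree < k) :
    EventuallyPoly k (fun n : ℕ => p.eval (n : ℝ)) := by
  refine Eventually.of_forall fun n => ?_
  have h : (Δ_[1])^[k] (fun n : ℕ => p.eval (n : ℝ)) n = (Δ_[(1 : ℝ)])^[k] p.eval (n : ℝ) := by
    simp [fwdDiff_iter_eq_sum_shift]
  rw [h]
  rcases eq_or_ne p 0 with rfl | h0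
  · simp [fwdDiff_iter_eq_sum_shift]
  · rw [Polynomial.fwdDiff_iter_eq_zero_of_degree_lt
      ((Polynomial.natDegree_lt_iff_degree_lt h0).2 hp)]
    rfl

/-- If the polynomial `p` of `f` had larger degree than the polynomial `q` of `g`, then `q = o(p)`,
so eventually |q| ≤ |p|/2. With 0 ≤ f ≤ g this forces `p` to vanish at large integers, where it has
no roots. -/
lemma EventuallyPoly.of_le {k d : ℕ} {f g : ℕ → ℝ} (hf : EventuallyPoly k f)
    (hg : EventuallyPoly d g) (h0 : ∀ n, 0 ≤ f n) (hfg : ∀ᶠ n in atTop, f n ≤ g n) :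
    EventuallyPoly d f := by
  obtain ⟨p, -, hp⟩ := hf.exists_polynomial
  obtain ⟨q, hqd, hq⟩ := hg.exists_polynomial
  refine (eventuallyPoly_eval (p := p) (lt_of_le_of_lt ?_ hqd)).congr
    (hp.mono fun _ h => h.symm)
  by_contra! hlt
  have hp0 : p ≠ 0 := by
    rintro rfl
    simp at hlt
  have ho := (Polynomial.isLittleO_atTop_of_degree_lt q p hlt).comp_tendsto
    (tendsto_natCast_atTop_atTop (R := ℝ))
  have hroot := (tendsto_natCast_atTop_atTop (R := ℝ)).eventually
    (p.eventually_atTop_not_isRoot hp0)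
  obtain ⟨n, h₁, h₂, h₃, h₄, h₅⟩ := (hroot.and (hp.and (hq.and (hfg.and
    (ho.def (show (0 : ℝ) < 1 / 2 by norm_num)))))).exists
  simp only [Function.comp_apply, Real.norm_eq_abs] at h₅
  have h₆ := h0 n
  rw [← h₃, ← h₂, abs_of_nonneg (h₆.trans h₄), abs_of_nonneg h₆] at h₅
  have h₇ : f n = 0 := by linarith
  exact h₁ (by rw [Polynomial.IsRoot, ← h₂, h₇])

lemma EventuallyPoly.exists_tendsto {d : ℕ} {f : ℕ → ℝ} (hf : EventuallyPoly d f) :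
    ∃ l, Tendsto (fun n : ℕ => f n / (n : ℝ) ^ (d - 1)) atTop (nhds l) := by
  obtain ⟨p, hpd, hp⟩ := hf.exists_polynomial
  have hc := tendsto_natCast_atTop_atTop (R := ℝ)
  suffices ∃ l, Tendsto (fun x : ℝ => p.eval x / (Polynomial.X ^ (d - 1) : Polynomial ℝ).eval x)
      atTop (nhds l) by
    obtain ⟨l, hl⟩ := this
    refine ⟨l, (hl.comp hc).congr' ?_⟩
    filter_upwards [hp] with n hn
    simp [hn]
  have hle : p.degree ≤ (Polynomial.X ^ (d - 1) : Polynomial ℝ).degree := by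
    rw [Polynomial.degree_X_pow]
    -- For `d = 0` the truncated exponent `d - 1` is `0`, but then `p = 0`.
    rcases d with _ | d
    · exact hpd.le
    · rcases eq_or_ne p 0 with rfl | h0
      · simp
      · exact Polynomial.degree_le_of_natDegree_le
          (Nat.lt_succ_iff.1 ((Polynomial.natDegree_lt_iff_degree_lt h0).2 hpd))
  rcases hle.lt_or_eq with h | h
  · exact ⟨0, Polynomial.div_tendsto_atTop_zero_of_degree_lt _ _ h⟩
  · exact ⟨_, Polynomial.div_tendsto_atTop_leadingCoeff_div_of_degree_eq _ _ h⟩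

/-! ### Lengths and the Hilbert–Serre theorem -/

/-- The length of a module as a real number, with junk value `0` for modules of infinite length. -/
def len (A : Type*) [CommRing A] (M : Type*) [AddCommGroup M] [Module A M] : ℝ :=
  ((Module.length A M).toNat : ℝ)

section Len

variable {A : Type*} [CommRing A] {M N P : Type*} [AddCommGroup M] [Module A M]
  [AddCommGroup N] [Module A N] [AddCommGroup P] [Module A P]

lemma len_nonneg : 0 ≤ len A M := Nat.cast_nonneg _

lemma len_congr (e : M ≃ₗ[A] N) : len A M = len A N := by
  rw [len, e.length_eq, len]

lemma length_ne_top_of_injective (h : Module.length A N ≠ ⊤) (f : M →ₗ[A] N)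
    (hf : Function.Injective f) : Module.length A M ≠ ⊤ :=
  ne_top_of_le_ne_top h (Module.length_le_of_injective f hf)

lemma length_ne_top_of_surjective (h : Module.length A M ≠ ⊤) (f : M →ₗ[A] N)
    (hf : Function.Surjective f) : Module.length A N ≠ ⊤ :=
  ne_top_of_le_ne_top h (Module.length_le_of_surjective f hf)

lemma len_le_of_surjective (h : Module.length A M ≠ ⊤) (f : M →ₗ[A] N)
    (hf : Function.Surjective f) : len A N ≤ len A M := by
  exact Nat.cast_le.2 (ENat.toNat_le_toNat (Module.length_le_of_surjective f hf) h)

lemma len_eq_add_of_exact (h : Module.length A M ≠ ⊤) (f : N →ₗ[A] M) (g : M →ₗ[A] P)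
    (hf : Function.Injective f) (hg : Function.Surjective g) (hfg : Function.Exact f g) :
    len A M = len A N + len A P := by
  have h₁ := length_ne_top_of_injective h f hf
  have h₂ := length_ne_top_of_surjective h g hg
  rw [len, Module.length_eq_add_of_exact f g hf hg hfg, ENat.toNat_add h₁ h₂, Nat.cast_add, len,
    len]

lemma len_le_add_of_exact (h : Module.length A M ≠ ⊤) (hN : Module.length A N ≠ ⊤)
    (f : N →ₗ[A] M) (g : M →ₗ[A] P) (hg : Function.Surjective g) (hfg : Function.Exact f g) :
    len A M ≤ len A N + len A P := by
  have h₁ := len_eq_add_of_exact h (LinearMap.range f).subtype g Subtype.val_injective hg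
    (LinearMap.exact_iff.2 (by rw [Submodule.range_subtype, hfg.linearMap_ker_eq]))
  have h₂ := len_le_of_surjective hN f.rangeRestrict f.surjective_rangeRestrict
  linarith

lemma len_prod (hM : Module.length A M ≠ ⊤) (hN : Module.length A N ≠ ⊤) :
    len A (M × N) = len A M + len A N := by
  rw [len, Module.length_prod, ENat.toNat_add hM hN, Nat.cast_add, len, len]

end Len

/-- **Hilbert–Serre**: let `G 0, G 1, …` be modules of finite length with `k` commuting families of
maps `x i : G n → G (n + 1)`, such that every stable family of submodules is eventually generated
by its predecessors. Then the length of `G n` is eventually polynomial of degree less than `k`. -/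
theorem eventuallyPoly_len {A : Type*} [CommRing A] (k : ℕ) :
    ∀ (G : ℕ → Type u) [∀ n, AddCommGroup (G n)] [∀ n, Module A (G n)]
      (x : Fin k → ∀ n, G n →ₗ[A] G (n + 1)),
      (∀ i j n g, x i (n + 1) (x j n g) = x j (n + 1) (x i n g)) →
      (∀ U : ∀ n, Submodule A (G n), (∀ i n, (U n).map (x i n) ≤ U (n + 1)) →
        ∀ᶠ n in atTop, U (n + 1) ≤ ⨆ i, (U n).map (x i n)) →
      (∀ n, Module.length A (G n) ≠ ⊤) →
      EventuallyPoly k (fun n => len A (G n)) := by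
  induction k with
  | zero =>
    intro G _ _ x _ hx hfin
    -- With no maps the supremum is empty, so the family of all of `G n` can only be generated by
    -- its predecessors if `G (n + 1) = 0` for large `n`.
    have h := hx (fun _ => ⊤) (fun i => i.elim0)
    refine EventuallyPoly.congr (f := fun _ => 0) (Eventually.of_forall fun _ => rfl) ?_
    refine (eventually_atTop.2 ?_)
    obtain ⟨N, hN⟩ := eventually_atTop.1 h
    refine ⟨N + 1, fun n hn => ?_⟩
    obtain ⟨m, rfl⟩ := Nat.exists_eq_add_of_le' hn
    have h1 := hN (m + N) (by omega)
    have : Subsingleton (G (m + N + 1)) := by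
      rw [iSup_of_empty, le_bot_iff] at h1
      exact (Submodule.subsingleton_iff A).1 (subsingleton_of_bot_eq_top h1.symm)
    have h2 : len A (G (m + N + 1)) = 0 := by
      rw [len, Module.length_eq_zero]
      simp
    exact h2.symm
  | succ k ih =>
    intro G _ _ x hcomm hx hfin
    refine EventuallyPoly.of_fwdDiff ?_
    -- The difference of lengths is ℓ(coker) − ℓ(ker) for `x 0 n : G n → G (n + 1)`. Since `x 0`
    -- acts as zero on both families, the other `k` maps satisfy the generation hypothesis there.
    have hmem : ∀ (i : Fin k) n, ∀ g ∈ LinearMap.ker (x 0 n),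
        x i.succ n g ∈ LinearMap.ker (x 0 (n + 1)) := by
      intro i n g hg
      rw [LinearMap.mem_ker] at hg ⊢
      rw [hcomm, hg, map_zero]
    have hker := ih (fun n => LinearMap.ker (x 0 n)) (fun i n => (x i.succ n).restrict (hmem i n))
      (fun i j n g => Subtype.ext (hcomm _ _ _ _)) (fun U hU => by
        have h := hx (fun n => (U n).map (LinearMap.ker (x 0 n)).subtype) (fun i n => by
          rintro _ ⟨_, ⟨g, hg, rfl⟩, rfl⟩
          refine Fin.cases ?_ (fun i => ?_) i
          · have : x 0 n g = 0 := g.2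
            simp [this]
          · exact ⟨_, hU i n ⟨g, hg, rfl⟩, rfl⟩)
        filter_upwards [h] with n hn
        rw [← Submodule.map_le_map_iff_of_injective (LinearMap.ker (x 0 (n + 1))).subtype_injective]
        refine hn.trans (iSup_le fun i => ?_)
        rintro _ ⟨_, ⟨g, hg, rfl⟩, rfl⟩
        refine Fin.cases ?_ (fun i => ?_) i
        · have : x 0 n g = 0 := g.2
          simp [this]
        · exact ⟨_, Submodule.mem_iSup_of_mem i ⟨g, hg, rfl⟩, rfl⟩)
      (fun n => length_ne_top_of_injective (hfin n) _ (LinearMap.ker (x 0 n)).subtype_injective)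
    have hle : ∀ (i : Fin k) n, LinearMap.range (x 0 n) ≤
        (LinearMap.range (x 0 (n + 1))).comap (x i.succ (n + 1)) := by
      rintro i n _ ⟨g, rfl⟩
      exact ⟨x i.succ n g, hcomm _ _ _ _⟩
    have hcoker := ih (fun n => G (n + 1) ⧸ LinearMap.range (x 0 n))
      (fun i n => Submodule.mapQ _ _ (x i.succ (n + 1)) (hle i n))
      (fun i j n g => by
        obtain ⟨g, rfl⟩ := Submodule.mkQ_surjective _ g
        simp [hcomm i.succ j.succ]) (fun U hU => by
        -- The cokernel at index `n` is a quotient of `G (n + 1)`, so the preimages start in degree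
        -- 1; `⊥` fills degree 0.
        have h := hx (fun n => match n with
          | 0 => ⊥
          | n + 1 => (U n).comap (LinearMap.range (x 0 n)).mkQ) (fun i n => by
          rcases n with _ | n
          · simp
          · rintro _ ⟨g, hg, rfl⟩
            refine Fin.cases ?_ (fun i => ?_) i
            · have : (LinearMap.range (x 0 (n + 1))).mkQ (x 0 (n + 1) g) = 0 := by simp
              exact Submodule.mem_comap.2 (this ▸ zero_mem _)
            · exact hU i n ⟨_, hg, rfl⟩)
        filter_upwards [(tendsto_add_atTop_nat 1).eventually h] with n hn
        have hn' := Submodule.map_mono (f := (LinearMap.range (x 0 (n + 1))).mkQ) hn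
        rw [Submodule.map_comap_eq_of_surjective (Submodule.mkQ_surjective _)] at hn'
        refine hn'.trans ?_
        rw [Submodule.map_iSup]
        refine iSup_le fun i => ?_
        rintro _ ⟨_, ⟨g, hg, rfl⟩, rfl⟩
        refine Fin.cases ?_ (fun i => ?_) i
        · have : (LinearMap.range (x 0 (n + 1))).mkQ (x 0 (n + 1) g) = 0 := by simp
          exact this ▸ zero_mem _
        · exact Submodule.mem_iSup_of_mem i ⟨_, hg, rfl⟩)
      (fun n => length_ne_top_of_surjective (hfin (n + 1)) _ (Submodule.mkQ_surjective _))
    refine (hcoker.sub hker).congr (Eventually.of_forall fun n => ?_)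
    have h1 := len_eq_add_of_exact (hfin n) (LinearMap.ker (x 0 n)).subtype (x 0 n).rangeRestrict
      Subtype.val_injective (x 0 n).surjective_rangeRestrict
      (LinearMap.exact_iff.2 (by simp))
    have h2 := len_eq_add_of_exact (hfin (n + 1)) (LinearMap.range (x 0 n)).subtype
      (LinearMap.range (x 0 n)).mkQ Subtype.val_injective (Submodule.mkQ_surjective _)
      (LinearMap.exact_iff.2 (by simp))
    simp only [Pi.sub_apply, fwdDiff]
    linarith

/-! ### The Hilbert–Samuel theorem -/

section HilbertSamuel

variable {A : Type*} [CommRing A] {M : Type u} [AddCommGroup M] [Module A M]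

/-- The `n`-th graded piece of `M` for the `I`-adic filtration. -/
abbrev adicPiece (I : Ideal A) (M : Type u) [AddCommGroup M] [Module A M] (n : ℕ) : Type u :=
  ↥(I ^ n • (⊤ : Submodule A M)) ⧸
    (I ^ (n + 1) • (⊤ : Submodule A M)).comap (I ^ n • (⊤ : Submodule A M)).subtype

lemma smul_mem_pow_succ_smul {I : Ideal A} {a : A} (ha : a ∈ I) {n : ℕ} {m : M}
    (hm : m ∈ I ^ n • (⊤ : Submodule A M)) : a • m ∈ I ^ (n + 1) • (⊤ : Submodule A M) := by
  rw [pow_succ', mul_smul]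
  exact Submodule.smul_mem_smul ha hm

/-- Multiplication by an element of `I` on the associated graded module. -/
def adicMul (I : Ideal A) (M : Type u) [AddCommGroup M] [Module A M] (a : A) (ha : a ∈ I) (n : ℕ) :
    adicPiece I M n →ₗ[A] adicPiece I M (n + 1) :=
  Submodule.mapQ _ _
    ((LinearMap.lsmul A M a).restrict fun _ hm => smul_mem_pow_succ_smul ha hm)
    fun _ hm => smul_mem_pow_succ_smul ha hm

lemma adicMul_mk (I : Ideal A) (a : A) (ha : a ∈ I) (n : ℕ)
    (m : ↥(I ^ n • (⊤ : Submodule A M))) :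
    adicMul I M a ha n (Submodule.Quotient.mk m) =
      Submodule.Quotient.mk ⟨a • m.1, smul_mem_pow_succ_smul ha m.2⟩ := rfl

/-- The submodule of `M` lying over a submodule of a graded piece. -/
def adicLift {I : Ideal A} {n : ℕ} (U : Submodule A (adicPiece I M n)) : Submodule A M :=
  (U.comap (Submodule.mkQ _)).map (I ^ n • (⊤ : Submodule A M)).subtype

lemma mem_adicLift {I : Ideal A} {n : ℕ} {U : Submodule A (adicPiece I M n)} {m : M} :
    m ∈ adicLift U ↔ ∃ h : m ∈ I ^ n • (⊤ : Submodule A M),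
      (Submodule.Quotient.mk ⟨m, h⟩ : adicPiece I M n) ∈ U := by
  constructor
  · rintro ⟨m, hm, rfl⟩
    exact ⟨m.2, hm⟩
  · rintro ⟨h, hm⟩
    exact ⟨⟨m, h⟩, hm, rfl⟩

/-- Translates between the graded pieces and `M`. It makes the lifts of a stable family an
`I`-filtration, and later turns stability of that filtration into generation of the graded pieces.
-/
lemma span_smul_adicLift_le {k : ℕ} (x : Fin k → A) {n : ℕ}
    (U : Submodule A (adicPiece (Ideal.span (Set.range x)) M n))
    (W : Submodule A (adicPiece (Ideal.span (Set.range x)) M (n + 1)))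
    (h : ∀ i, U.map (adicMul _ M (x i) (Ideal.subset_span (Set.mem_range_self i)) n) ≤ W) :
    Ideal.span (Set.range x) • adicLift U ≤ adicLift W := by
  rw [Submodule.smul_le]
  intro r hr m hm
  induction hr using Submodule.span_induction with
  | mem r hr =>
    obtain ⟨i, rfl⟩ := hr
    obtain ⟨h', hm⟩ := mem_adicLift.1 hm
    exact mem_adicLift.2 ⟨smul_mem_pow_succ_smul (Ideal.subset_span (Set.mem_range_self i)) h',
      h i ⟨_, hm, rfl⟩⟩
  | zero => simp
  | add a b _ _ ha hb =>
    rw [add_smul]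
    exact add_mem ha hb
  | smul a b _ hb =>
    rw [smul_eq_mul, mul_smul]
    exact Submodule.smul_mem _ _ hb

/-- **Hilbert–Samuel**: if `I` is generated by `k` elements and the modules `M / I ^ n M` have
finite length, these lengths are eventually polynomial of degree at most `k`. -/
theorem eventuallyPoly_len_quotient [IsNoetherianRing A] [Module.Finite A M] {k : ℕ}
    (x : Fin k → A) (I : Ideal A) (hI : I = Ideal.span (Set.range x))
    (hfin : ∀ n, Module.length A (M ⧸ (I ^ n • ⊤ : Submodule A M)) ≠ ⊤) :
    EventuallyPoly (k + 1) (fun n => len A (M ⧸ (I ^ n • ⊤ : Submodule A M))) := by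
  subst hI
  set I := Ideal.span (Set.range x)
  have hx : ∀ i, x i ∈ I := fun i => Ideal.subset_span ⟨i, rfl⟩
  have hle : ∀ n, I ^ (n + 1) • (⊤ : Submodule A M) ≤ I ^ n • ⊤ := fun n =>
    Submodule.smul_mono_left (Ideal.pow_le_pow_right n.le_succ)
  let φ : ∀ n, adicPiece I M n →ₗ[A] M ⧸ (I ^ (n + 1) • ⊤ : Submodule A M) := fun n =>
    Submodule.mapQ _ _ (I ^ n • (⊤ : Submodule A M)).subtype le_rfl
  have hφ : ∀ n, Function.Injective (φ n) := by
    intro n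
    rw [← LinearMap.ker_eq_bot, Submodule.ker_mapQ, Submodule.mkQ_map_self]
  have hφ' : ∀ n, Function.Exact (φ n) (Submodule.factor (hle n)) := by
    intro n
    rw [LinearMap.exact_iff]
    ext y
    obtain ⟨y, rfl⟩ := Submodule.mkQ_surjective _ y
    constructor
    · intro hy
      refine ⟨Submodule.Quotient.mk ⟨y, ?_⟩, rfl⟩
      simpa using hy
    · rintro ⟨z, hz⟩
      obtain ⟨z, rfl⟩ := Submodule.mkQ_surjective _ z
      rw [← hz]
      simp [φ]
  refine EventuallyPoly.of_fwdDiff ((eventuallyPoly_len k (fun n => adicPiece I M n)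
    (fun i n => adicMul I M (x i) (hx i) n) ?_ ?_ ?_).congr (Eventually.of_forall fun n => ?_))
  · intro i j n g
    obtain ⟨g, rfl⟩ := Submodule.mkQ_surjective _ g
    simp only [Submodule.mkQ_apply, adicMul_mk, smul_comm (x i) (x j)]
  · intro U hU
    let F : I.Filtration M :=
      { N := fun n => adicLift (U n)
        mono := fun n m hm => by
          obtain ⟨h, -⟩ := mem_adicLift.1 hm
          refine mem_adicLift.2 ⟨hle n h, ?_⟩
          have : (Submodule.Quotient.mk ⟨m, hle n h⟩ : adicPiece I M n) = 0 :=
            (Submodule.Quotient.mk_eq_zero _).2 h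
          rw [this]
          exact zero_mem _
        smul_le := fun n => span_smul_adicLift_le x _ _ (fun i => hU i n) }
    have hF : F ≤ I.stableFiltration ⊤ := fun n m hm => (mem_adicLift.1 hm).1
    -- Artin–Rees: a filtration contained in a stable one is stable. This replaces noetherianity of
    -- the associated graded module.
    obtain ⟨n₀, hn₀⟩ := (I.stableFiltration_stable ⊤).of_le hF
    filter_upwards [eventually_ge_atTop n₀] with n hn u hu
    obtain ⟨u, rfl⟩ := Submodule.mkQ_surjective _ u
    have h₁ : u.1 ∈ F.N (n + 1) := mem_adicLift.2 ⟨u.2, hu⟩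
    rw [← hn₀ n hn] at h₁
    exact (mem_adicLift.1 (span_smul_adicLift_le x (U n) _ (fun i =>
      le_iSup (fun i => (U n).map (adicMul I M (x i) (hx i) n)) i) h₁)).2
  · intro n
    exact length_ne_top_of_injective (hfin (n + 1)) (φ n) (hφ n)
  · have h := len_eq_add_of_exact (hfin (n + 1)) (φ n) (Submodule.factor (hle n)) (hφ n)
      (Submodule.factor_surjective _) (hφ' n)
    simp only [fwdDiff]
    linarith

end HilbertSamuel

/-! ### Tor₁ from a projective presentation -/

section TorLength

variable {A : Type u} [CommRing A]

/-- The kernel of `K ⊗ B → F ⊗ B` for a projective presentation `0 → K → F → M → 0` does not grow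
when the presentation is changed. -/
lemma length_ker_rTensor_le {K F K' F' M : Type*} [AddCommGroup K] [Module A K] [AddCommGroup F]
    [Module A F] [AddCommGroup K'] [Module A K'] [AddCommGroup F'] [Module A F']
    [AddCommGroup M] [Module A M] [Module.Projective A F] [Module.Projective A F']
    {j : K →ₗ[A] F} {π : F →ₗ[A] M} {j' : K' →ₗ[A] F'} {π' : F' →ₗ[A] M}
    (hj : Function.Injective j) (hπ : Function.Surjective π) (h : Function.Exact j π)
    (hj' : Function.Injective j') (hπ' : Function.Surjective π') (h' : Function.Exact j' π')
    (B : Type*) [AddCommGroup B] [Module A B] :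
    Module.length A (LinearMap.ker (j.rTensor B)) ≤
      Module.length A (LinearMap.ker (j'.rTensor B)) := by
  obtain ⟨φ, hφ⟩ := Module.projective_lifting_property π' π hπ'
  obtain ⟨ψ, hψ⟩ := Module.projective_lifting_property π π' hπ
  have hφ' : ∀ x, π' (φ x) = π x := fun x => LinearMap.congr_fun hφ x
  have hψ' : ∀ x, π (ψ x) = π' x := fun x => LinearMap.congr_fun hψ x
  let φK : K →ₗ[A] K' := LinearMap.codRestrictOfInjective (φ ∘ₗ j) j' hj' fun x =>
    (h' _).1 (by simp [hφ', h.apply_apply_eq_zero])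
  let ψK : K' →ₗ[A] K := LinearMap.codRestrictOfInjective (ψ ∘ₗ j') j hj fun x =>
    (h _).1 (by simp [hψ', h'.apply_apply_eq_zero])
  -- The map 1 − ψφ covers zero on `M`, hence lands in `K`. This homotopy gives 1 = ψK φK + s j on
  -- `K`, and s j dies on ker(j ⊗ B), so φK ⊗ B is injective there.
  let s : F →ₗ[A] K := LinearMap.codRestrictOfInjective (LinearMap.id - ψ ∘ₗ φ) j hj fun x =>
    (h _).1 (by simp [hψ', hφ'])
  have e₁ : j' ∘ₗ φK = φ ∘ₗ j := LinearMap.codRestrictOfInjective_comp _ _ _ _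
  have e₂ : LinearMap.id = ψK ∘ₗ φK + s ∘ₗ j := by
    ext x
    apply hj
    have h₁ : ∀ y, j (ψK y) = ψ (j' y) :=
      LinearMap.codRestrictOfInjective_comp_apply _ _ _ _
    have h₂ : ∀ y, j' (φK y) = φ (j y) :=
      LinearMap.codRestrictOfInjective_comp_apply _ _ _ _
    have h₃ : ∀ y, j (s y) = y - ψ (φ y) :=
      LinearMap.codRestrictOfInjective_comp_apply _ _ _ _
    simp [h₁, h₂, h₃]
  have hmem : ∀ x ∈ LinearMap.ker (j.rTensor B), φK.rTensor B x ∈ LinearMap.ker (j'.rTensor B) := by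
    intro x hx
    rw [LinearMap.mem_ker] at hx ⊢
    rw [← LinearMap.rTensor_comp_apply, e₁, LinearMap.rTensor_comp_apply, hx, map_zero]
  refine Module.length_le_of_injective ((φK.rTensor B).restrict hmem) ?_
  rw [injective_iff_map_eq_zero]
  rintro ⟨x, hx⟩ hx0
  have hx0' : φK.rTensor B x = 0 := congrArg Subtype.val hx0
  rw [LinearMap.mem_ker] at hx
  ext
  have := LinearMap.congr_fun (congrArg (LinearMap.rTensor B) e₂) x
  rw [LinearMap.rTensor_id, LinearMap.rTensor_add, LinearMap.add_apply,
    LinearMap.rTensor_comp_apply, LinearMap.rTensor_comp_apply, hx, hx0', map_zero, map_zero,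
    add_zero] at this
  exact this

/-- Since ker r = im d₂, the map `r` identifies ker(i r)/im d₂ with ker i. -/
lemma length_ker_quotient_range {X₀ X₁ X₂ W : Type*} [AddCommGroup X₀] [Module A X₀]
    [AddCommGroup X₁] [Module A X₁] [AddCommGroup X₂] [Module A X₂] [AddCommGroup W] [Module A W]
    (d₂ : X₂ →ₗ[A] X₁) (d₁ : X₁ →ₗ[A] X₀) (r : X₁ →ₗ[A] W) (i : W →ₗ[A] X₀) (hc : d₁ = i ∘ₗ r)
    (hr : Function.Surjective r) (hex : Function.Exact d₂ r)
    (h : ∀ x, d₂ x ∈ LinearMap.ker d₁) :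
    Module.length A (LinearMap.ker d₁ ⧸ LinearMap.range (d₂.codRestrict (LinearMap.ker d₁) h)) =
      Module.length A (LinearMap.ker i) := by
  subst hc
  let θ : LinearMap.ker (i ∘ₗ r) →ₗ[A] LinearMap.ker i := r.restrict fun x hx => hx
  have hθ : Function.Surjective θ := by
    rintro ⟨y, hy⟩
    obtain ⟨x, rfl⟩ := hr y
    exact ⟨⟨x, hy⟩, rfl⟩
  have hk : LinearMap.range (d₂.codRestrict (LinearMap.ker (i ∘ₗ r)) h) = LinearMap.ker θ := by
    ext ⟨x, hx⟩
    constructor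
    · rintro ⟨y, hy⟩
      exact Subtype.ext ((hex x).2 ⟨y, congrArg Subtype.val hy⟩)
    · intro hx
      obtain ⟨y, hy⟩ := (hex x).1 (congrArg Subtype.val hx)
      exact ⟨y, Subtype.ext hy⟩
  exact (Submodule.quotEquivOfEq _ _ hk ≪≫ₗ θ.quotKerEquivOfSurjective hθ).length_eq

/-- Right exactness of the tensor product keeps P₂ → P₁ → im d₁ → 0 exact, so the homology is the
failure of im d₁ → P₀ to stay injective. -/
lemma length_homology_rTensor {P₀ P₁ P₂ : Type*} [AddCommGroup P₀] [Module A P₀] [AddCommGroup P₁]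
    [Module A P₁] [AddCommGroup P₂] [Module A P₂] (d₂ : P₂ →ₗ[A] P₁) (d₁ : P₁ →ₗ[A] P₀)
    (hd : Function.Exact d₂ d₁) (B : Type*) [AddCommGroup B] [Module A B]
    (h : ∀ x, d₂.rTensor B x ∈ LinearMap.ker (d₁.rTensor B)) :
    Module.length A (LinearMap.ker (d₁.rTensor B) ⧸
        LinearMap.range ((d₂.rTensor B).codRestrict (LinearMap.ker (d₁.rTensor B)) h)) =
      Module.length A (LinearMap.ker ((LinearMap.range d₁).subtype.rTensor B)) := by
  refine length_ker_quotient_range (d₂.rTensor B) (d₁.rTensor B) (d₁.rangeRestrict.rTensor B) _ ?_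
    (LinearMap.rTensor_surjective B d₁.surjective_rangeRestrict)
    (rTensor_exact B (f := d₂) (g := d₁.rangeRestrict)
      (LinearMap.exact_iff.2 (by rw [LinearMap.ker_rangeRestrict, hd.linearMap_ker_eq]))
      d₁.surjective_rangeRestrict) h
  rw [← LinearMap.rTensor_comp]
  rfl

/-- The length of `Tor₁(M, B)` computed from a projective presentation of `M`. -/
theorem length_tor_one {K F : Type*} [AddCommGroup K] [Module A K] [AddCommGroup F]
    [Module A F] [Module.Projective A F] (M B : ModuleCat.{u} A)
    {j : K →ₗ[A] F} {π : F →ₗ[A] M} (hj : Function.Injective j) (hπ : Function.Surjective π)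
    (h : Function.Exact j π) :
    Module.length A (((Tor' (ModuleCat.{u} A) 1).obj M).obj B) =
      Module.length A (LinearMap.ker (j.rTensor B)) := by
  let P := projectiveResolution M
  let T := (MonoidalCategory.tensoringRight (ModuleCat.{u} A)).obj B
  have e₁ : ((Tor' (ModuleCat.{u} A) 1).obj M).obj B ≅
      ((T.mapHomologicalComplex _).obj P.complex).homology 1 := P.isoLeftDerivedObj T 1
  have e₂ : ((T.mapHomologicalComplex _).obj P.complex).homology 1 ≅
      (((T.mapHomologicalComplex _).obj P.complex).sc' 2 1 0).homology :=
    ShortComplex.homologyMapIso (((T.mapHomologicalComplex _).obj P.complex).isoSc' 2 1 0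
      (by simp) (by simp))
  have e₃ := (((T.mapHomologicalComplex _).obj P.complex).sc' 2 1 0).moduleCatHomologyIso
  rw [(e₁ ≪≫ e₂ ≪≫ e₃).toLinearEquiv.length_eq]
  have hd : Function.Exact (P.complex.d 2 1).hom (P.complex.d 1 0).hom :=
    (ShortComplex.ShortExact.moduleCat_exact_iff_function_exact _).1 (P.exact_succ 0)
  have h₀ : Function.Exact (P.complex.d 1 0).hom (P.π.f 0).hom :=
    (ShortComplex.ShortExact.moduleCat_exact_iff_function_exact _).1 P.exact₀
  have hs : Function.Surjective (P.π.f 0).hom := (ModuleCat.epi_iff_surjective _).1 inferInstance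
  have hp : Module.Projective A (P.complex.X 0) :=
    (IsProjective.iff_projective _).2 (P.projective 0)
  have hex : Function.Exact (LinearMap.range (P.complex.d 1 0).hom).subtype (P.π.f 0).hom :=
    LinearMap.exact_iff.2 (by rw [Submodule.range_subtype, h₀.linearMap_ker_eq])
  refine (length_homology_rTensor (P.complex.d 2 1).hom (P.complex.d 1 0).hom hd B _).trans ?_
  exact le_antisymm
    (length_ker_rTensor_le Subtype.val_injective hs hex hj hπ h B)
    (length_ker_rTensor_le hj hπ h Subtype.val_injective hs hex B)

end TorLength

lemma EventuallyPoly.of_comp_add {k c : ℕ} {f : ℕ → ℝ}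
    (hf : EventuallyPoly k (fun n => f (n + c))) : EventuallyPoly k f := by
  obtain ⟨N, hN⟩ := eventually_atTop.1 hf
  refine eventually_atTop.2 ⟨N + c, fun n hn => ?_⟩
  obtain ⟨m, rfl⟩ := Nat.exists_eq_add_of_le' (le_of_add_le_right hn)
  have := hN m (by omega)
  rwa [fwdDiff_iter_comp_add] at this

/-! ### Hilbert–Samuel functions and Artin–Rees -/

section HilbertFunction

variable (A : Type u) [CommRing A] [IsLocalRing A]

/-- The Hilbert–Samuel function `n ↦ ℓ(M / 𝔪ⁿ M)`. -/
def hs (M : Type u) [AddCommGroup M] [Module A M] (n : ℕ) : ℝ :=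
  len A (M ⊗[A] (A ⧸ maximalIdeal A ^ n))

variable {A}
variable {M N E : Type u} [AddCommGroup M] [Module A M] [AddCommGroup N] [Module A N]
  [AddCommGroup E] [Module A E]

lemma hs_eq (n : ℕ) : hs A M n = len A (M ⧸ (maximalIdeal A ^ n • ⊤ : Submodule A M)) :=
  len_congr (tensorQuotEquivQuotSMul M (maximalIdeal A ^ n))

lemma maximalIdeal_mem_minimalPrimes_self :
    maximalIdeal A ∈ (maximalIdeal A).minimalPrimes := by
  simp [Ideal.minimalPrimes_eq_subsingleton_self]

section Finite

variable [IsNoetherianRing A] [Module.Finite A M]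

lemma length_quotient_pow_ne_top {I : Ideal A} (hI : maximalIdeal A ∈ I.minimalPrimes) (n : ℕ) :
    Module.length A (M ⧸ (I ^ n • ⊤ : Submodule A M)) ≠ ⊤ := by
  have hart : IsArtinianRing (A ⧸ I ^ n) := by
    rcases eq_or_ne n 0 with rfl | hn
    · rw [pow_zero, Ideal.one_eq_top]
      have : Subsingleton (A ⧸ (⊤ : Ideal A)) := Ideal.Quotient.subsingleton_iff.2 rfl
      infer_instance
    · refine IsLocalRing.quotient_artinian_of_mem_minimalPrimes_of_isLocalRing _ ?_
      rwa [← Ideal.radical_minimalPrimes, Ideal.radical_pow _ hn, Ideal.radical_minimalPrimes]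
  rw [Module.length_eq_of_surjective (R := A ⧸ I ^ n) Ideal.Quotient.mk_surjective]
  have : Module.Finite (A ⧸ I ^ n) (M ⧸ (I ^ n • ⊤ : Submodule A M)) :=
    Module.Finite.of_restrictScalars_finite A _ _
  exact Module.length_ne_top

lemma length_tensor_ne_top (n : ℕ) :
    Module.length A (M ⊗[A] (A ⧸ maximalIdeal A ^ n)) ≠ ⊤ := by
  rw [(tensorQuotEquivQuotSMul M (maximalIdeal A ^ n)).length_eq]
  exact length_quotient_pow_ne_top maximalIdeal_mem_minimalPrimes_self n

/-- A system of parameters: it bounds the degree of the Hilbert–Samuel polynomial by `dim A`. -/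
lemma exists_height_eq_dim :
    ∃ s : Finset A, maximalIdeal A ∈ (Ideal.span (s : Set A)).minimalPrimes ∧ s.card = dim A := by
  obtain ⟨s, hs, hc⟩ := (maximalIdeal A).exists_finset_card_eq_height_of_isNoetherianRing
  refine ⟨s, hs, ?_⟩
  rw [dim, ← IsLocalRing.maximalIdeal_height_eq_ringKrullDim, ← hc]
  rfl

/-- The Hilbert–Samuel function is eventually polynomial of degree at most `dim A`. -/
theorem eventuallyPoly_hs : EventuallyPoly (dim A + 1) (hs A M) := by
  have key : ∀ (s : Finset A) (I : Ideal A), I = Ideal.span (s : Set A) →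
      maximalIdeal A ∈ I.minimalPrimes →
      EventuallyPoly (s.card + 1) (fun n => len A (M ⧸ (I ^ n • ⊤ : Submodule A M))) := by
    intro s I hI hm
    refine eventuallyPoly_len_quotient (fun i => (s.equivFin.symm i : A)) I ?_
      (length_quotient_pow_ne_top hm)
    rw [hI]
    congr 1
    ext a
    constructor
    · intro ha
      exact ⟨s.equivFin ⟨a, ha⟩, by simp⟩
    · rintro ⟨i, rfl⟩
      exact (s.equivFin.symm i).2
  -- Generators of 𝔪 show polynomiality, with too large a degree. A parameter ideal J ⊆ 𝔪 corrects
  -- the degree, since M/JⁿM surjects onto M/𝔪ⁿM.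
  obtain ⟨t, ht⟩ := (isNoetherianRing_iff_ideal_fg A).1 inferInstance (maximalIdeal A)
  have h₁ := key t _ ht.symm maximalIdeal_mem_minimalPrimes_self
  obtain ⟨s, hs', hc⟩ := exists_height_eq_dim (A := A)
  have h₂ := key s _ rfl hs'
  rw [hc] at h₂
  refine (EventuallyPoly.of_le h₁ h₂ (fun _ => len_nonneg)
    (Eventually.of_forall fun n => ?_)).congr (Eventually.of_forall fun n => (hs_eq n).symm)
  exact len_le_of_surjective (length_quotient_pow_ne_top hs' n)
    (Submodule.factor (Submodule.smul_mono_left (Ideal.pow_right_mono hs'.1.2 n)))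
    (Submodule.factor_surjective _)

end Finite

variable [IsNoetherianRing A] [Module.Finite A N] [Module.Finite A E]

lemma hs_le_add (i : N →ₗ[A] E) (p : E →ₗ[A] M) (hp : Function.Surjective p)
    (h : Function.Exact i p) (n : ℕ) : hs A E n ≤ hs A N n + hs A M n :=
  len_le_add_of_exact (length_tensor_ne_top n) (length_tensor_ne_top n) (i.rTensor _)
    (p.rTensor _) (LinearMap.rTensor_surjective _ hp) (rTensor_exact _ h hp)

lemma hs_prod (n : ℕ) : hs A (N × E) n = hs A N n + hs A E n := by
  rw [hs, len_congr (TensorProduct.prodLeft A A N E _),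
    len_prod (length_tensor_ne_top n) (length_tensor_ne_top n), hs, hs]

/-- A numerical form of the Artin–Rees lemma. -/
lemma exists_hs_ker_le (π : E →ₗ[A] M) (hπ : Function.Surjective π) :
    ∃ c, ∀ n, hs A (LinearMap.ker π) n ≤ hs A E (n + c) - hs A M (n + c) := by
  obtain ⟨c, hc⟩ := (maximalIdeal A).exists_pow_inf_eq_pow_smul (LinearMap.ker π)
  refine ⟨c, fun n => ?_⟩
  set I := maximalIdeal A
  set K := LinearMap.ker π
  -- Artin–Rees: K ∩ Iⁿ⁺ᶜE = Iⁿ(K ∩ IᶜE) ⊆ IⁿK. Hence K/IⁿK is a quotient of K/(K ∩ Iⁿ⁺ᶜE), the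
  -- kernel of E/Iⁿ⁺ᶜE → M/Iⁿ⁺ᶜM.
  have hle : (I ^ (n + c) • (⊤ : Submodule A E)).comap K.subtype ≤ I ^ n • ⊤ := by
    intro x hx
    have h₁ : x.1 ∈ I ^ (n + c) • ⊤ ⊓ K := ⟨hx, x.2⟩
    rw [hc _ (Nat.le_add_left c n), Nat.add_sub_cancel] at h₁
    have h₂ : x.1 ∈ (I ^ n • (⊤ : Submodule A K)).map K.subtype := by
      rw [Submodule.map_smul'', Submodule.map_subtype_top]
      exact smul_mono_right (I ^ n) (inf_le_right : I ^ c • ⊤ ⊓ K ≤ K) h₁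
    obtain ⟨y, hy, hyx⟩ := h₂
    rwa [← Subtype.ext hyx]
  have hmap : I ^ (n + c) • (⊤ : Submodule A M) = (I ^ (n + c) • (⊤ : Submodule A E)).map π := by
    rw [Submodule.map_smul'', Submodule.map_top, LinearMap.range_eq_top.2 hπ]
  let φ := Submodule.mapQ ((I ^ (n + c) • (⊤ : Submodule A E)).comap K.subtype)
    (I ^ (n + c) • (⊤ : Submodule A E)) K.subtype le_rfl
  let ψ := Submodule.mapQ (I ^ (n + c) • (⊤ : Submodule A E)) (I ^ (n + c) • (⊤ : Submodule A M)) π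
    (by rw [hmap]; exact Submodule.le_comap_map _ _)
  have hφ : Function.Injective φ := by
    rw [← LinearMap.ker_eq_bot, Submodule.ker_mapQ, Submodule.mkQ_map_self]
  have hψ : Function.Surjective ψ := by
    intro y
    obtain ⟨y, rfl⟩ := Submodule.mkQ_surjective _ y
    obtain ⟨x, rfl⟩ := hπ y
    exact ⟨Submodule.Quotient.mk x, rfl⟩
  have hex : Function.Exact φ ψ := by
    intro y
    obtain ⟨y, rfl⟩ := Submodule.mkQ_surjective _ y
    constructor
    · intro hy
      have hy' : π y ∈ I ^ (n + c) • (⊤ : Submodule A M) :=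
        (Submodule.Quotient.mk_eq_zero _).1 hy
      rw [hmap] at hy'
      obtain ⟨z, hz, hzy⟩ := hy'
      refine ⟨Submodule.Quotient.mk ⟨y - z, by simp [K, hzy]⟩, ?_⟩
      refine (Submodule.Quotient.eq _).2 ?_
      simpa using hz
    · rintro ⟨z, hz⟩
      obtain ⟨z, rfl⟩ := Submodule.mkQ_surjective _ z
      rw [← hz]
      have : π z.1 = 0 := z.2
      simp [φ, ψ, this]
  have hE := length_quotient_pow_ne_top (M := E)
    (maximalIdeal_mem_minimalPrimes_self (A := A)) (n + c)
  have h₁ := len_eq_add_of_exact hE φ ψ hφ hψ hex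
  have h₂ := len_le_of_surjective (length_ne_top_of_injective hE φ hφ) (Submodule.factor hle)
    (Submodule.factor_surjective _)
  rw [hs_eq, hs_eq, hs_eq]
  linarith

end HilbertFunction

lemma eTSeq_eq {A : Type u} [CommRing A] [IsLocalRing A] (M : ModuleCat.{u} A) (n : ℕ) :
    eTSeq A M n =
    ((dim A - 1).factorial : ℝ) / (n : ℝ) ^ (dim A - 1) * len A (torOne A M n) := rfl

/-! ### Existence, subadditivity and additivity of `e^T` -/

section TorOne

variable {A : Type u} [CommRing A] [IsLocalRing A] [IsNoetherianRing A]
variable {K F M : Type u} [AddCommGroup K] [Module A K] [AddCommGroup F] [Module A F]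
  [AddCommGroup M] [Module A M] [Module.Finite A K] [Module.Finite A F] [Module.Projective A F]

/-- The alternating sum of lengths along 0 → Tor₁(M, B) → K ⊗ B → F ⊗ B → M ⊗ B → 0 with B = A/𝔪ⁿ⁺¹.
-/
lemma len_torOne_eq {j : K →ₗ[A] F} {π : F →ₗ[A] M} (hj : Function.Injective j)
    (hπ : Function.Surjective π) (h : Function.Exact j π) (n : ℕ) :
    Module.length A (torOne A (ModuleCat.of A M) n) ≠ ⊤ ∧
    len A (torOne A (ModuleCat.of A M) n) =
      hs A K (n + 1) - hs A F (n + 1) + hs A M (n + 1) := by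
  have hl := length_tor_one (ModuleCat.of A M)
    (ModuleCat.of A (A ⧸ maximalIdeal A ^ (n + 1))) hj hπ h
  change Module.length A (torOne A (ModuleCat.of A M) n) = _ at hl
  refine ⟨?_, ?_⟩
  · rw [hl]
    exact length_ne_top_of_injective (length_tensor_ne_top (n + 1)) (Submodule.subtype _)
      Subtype.val_injective
  · rw [len, hl]
    have h₁ := len_eq_add_of_exact (length_tensor_ne_top (M := K) (n + 1))
      (LinearMap.ker (j.rTensor (A ⧸ maximalIdeal A ^ (n + 1)))).subtype
      (j.rTensor (A ⧸ maximalIdeal A ^ (n + 1))).rangeRestrict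
      Subtype.val_injective (LinearMap.surjective_rangeRestrict _)
      (LinearMap.exact_iff.2 (by simp))
    have h₂ := len_eq_add_of_exact (length_tensor_ne_top (M := F) (n + 1))
      (LinearMap.range (j.rTensor (A ⧸ maximalIdeal A ^ (n + 1)))).subtype
      (π.rTensor (A ⧸ maximalIdeal A ^ (n + 1))) Subtype.val_injective
      (LinearMap.rTensor_surjective _ hπ)
      (LinearMap.exact_iff.2 (by
        rw [Submodule.range_subtype, (rTensor_exact _ h hπ).linearMap_ker_eq]))
    rw [hs, hs, hs, h₁, h₂]
    simp only [len]
    ring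

variable [Module.Finite A M]

lemma eventuallyPoly_len_torOne (M : Type u) [AddCommGroup M] [Module A M] [Module.Finite A M] :
    EventuallyPoly (dim A) (fun n => len A (torOne A (ModuleCat.of A M) n)) := by
  obtain ⟨r, π, hπ⟩ := Module.Finite.exists_fin' A M
  have heq := fun n => (len_torOne_eq (LinearMap.ker π).subtype_injective hπ
    (LinearMap.exact_subtype_ker_map π) n).2
  obtain ⟨c, hc⟩ := exists_hs_ker_le π hπ
  have hK := eventuallyPoly_hs (A := A) (M := LinearMap.ker π)
  have hP : EventuallyPoly (dim A + 1) (fun n => len A (torOne A (ModuleCat.of A M) n)) := by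
    refine (((hK.comp_add 1).sub ((eventuallyPoly_hs (A := A) (M := Fin r → A)).comp_add 1)).add
      ((eventuallyPoly_hs (A := A) (M := M)).comp_add 1)).congr
      (Eventually.of_forall fun n => (heq n).symm)
  -- By Artin–Rees the length at `n + c` is at most `hs K (n + 1 + c) - hs K (n + 1)`, an increment
  -- in which the leading term cancels.
  refine EventuallyPoly.of_comp_add (c := c) (EventuallyPoly.of_le (hP.comp_add c)
    ((hK.comp_add_sub c).comp_add 1) (fun _ => len_nonneg) (Eventually.of_forall fun n => ?_))
  have h₁ := hc (n + 1)
  have h₂ := heq (n + c)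
  rw [show n + 1 + c = n + c + 1 by omega] at h₁ ⊢
  linarith

variable (M) in
lemma tendsto_eTSeq :
    Tendsto (eTSeq A (ModuleCat.of A M)) atTop (nhds (eT A (ModuleCat.of A M))) := by
  obtain ⟨l, hl⟩ := (eventuallyPoly_len_torOne (A := A) M).exists_tendsto
  refine tendsto_nhds_limUnder ⟨(dim A - 1).factorial * l, ?_⟩
  refine (hl.const_mul ((dim A - 1).factorial : ℝ)).congr fun n => ?_
  rw [eTSeq, len]
  ring

variable (M) in
lemma length_torOne_ne_top (n : ℕ) : Module.length A (torOne A (ModuleCat.of A M) n) ≠ ⊤ := by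
  obtain ⟨r, π, hπ⟩ := Module.Finite.exists_fin' A M
  exact (len_torOne_eq (LinearMap.ker π).subtype_injective hπ
    (LinearMap.exact_subtype_ker_map π) n).1

variable {N E : Type u} [AddCommGroup N] [Module A N] [AddCommGroup E] [Module A E]
  [Module.Finite A N] [Module.Finite A E]

lemma len_torOne_le_add {i : N →ₗ[A] E} {p : E →ₗ[A] M} (hi : Function.Injective i)
    (hp : Function.Surjective p) (h : Function.Exact i p) (n : ℕ) :
    len A (torOne A (ModuleCat.of A E) n) ≤
      len A (torOne A (ModuleCat.of A N) n) + len A (torOne A (ModuleCat.of A M) n) := by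
  obtain ⟨r, π, hπ⟩ := Module.Finite.exists_fin' A N
  obtain ⟨s, ρ, hρ⟩ := Module.Finite.exists_fin' A M
  obtain ⟨σ, hσ⟩ := Module.projective_lifting_property p ρ hp
  have hσ' : ∀ x, p (σ x) = ρ x := fun x => LinearMap.congr_fun hσ x
  -- Horseshoe lemma: the kernels of π, τ, ρ form a short exact sequence. In the length formula the
  -- free terms add up exactly, while the kernel terms and the module terms are subadditive.
  let τ : (Fin r → A) × (Fin s → A) →ₗ[A] E := (i ∘ₗ π).coprod σ
  have hτ' : ∀ a b, τ (a, b) = i (π a) + σ b := fun a b => rfl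
  have hτ : Function.Surjective τ := by
    intro e
    obtain ⟨b, hb⟩ := hρ (p e)
    obtain ⟨x, hx⟩ := (h (e - σ b)).1 (by rw [map_sub, hσ', hb, sub_self])
    obtain ⟨a, rfl⟩ := hπ x
    exact ⟨(a, b), by rw [hτ', hx, sub_add_cancel]⟩
  let f : LinearMap.ker π →ₗ[A] LinearMap.ker τ :=
    (LinearMap.inl A _ _).restrict fun a ha => by
      rw [LinearMap.mem_ker] at ha ⊢
      simp [hτ', ha]
  let g : LinearMap.ker τ →ₗ[A] LinearMap.ker ρ :=
    (LinearMap.snd A _ _).restrict fun x hx => by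
      obtain ⟨a, b⟩ := x
      have := congrArg p (LinearMap.mem_ker.1 hx)
      rwa [hτ', map_add, h.apply_apply_eq_zero, zero_add, hσ', map_zero] at this
  have hg : Function.Surjective g := by
    rintro ⟨b, hb⟩
    obtain ⟨x, hx⟩ := (h (σ b)).1 (by rw [hσ', hb])
    obtain ⟨a, rfl⟩ := hπ x
    exact ⟨⟨(-a, b), by simp [hτ', hx]⟩, rfl⟩
  have hfg : Function.Exact f g := by
    rintro ⟨⟨a, b⟩, hab⟩
    constructor
    · intro hb
      obtain rfl : b = 0 := congrArg Subtype.val hb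
      have ha : π a = 0 := by
        apply hi
        simpa [hτ'] using hab
      exact ⟨⟨a, ha⟩, rfl⟩
    · rintro ⟨a', ha'⟩
      have := congrArg (fun z => z.1.2) ha'
      exact Subtype.ext this.symm
  rw [(len_torOne_eq (LinearMap.ker τ).subtype_injective hτ
      (LinearMap.exact_subtype_ker_map τ) n).2,
    (len_torOne_eq (LinearMap.ker π).subtype_injective hπ
      (LinearMap.exact_subtype_ker_map π) n).2,
    (len_torOne_eq (LinearMap.ker ρ).subtype_injective hρ
      (LinearMap.exact_subtype_ker_map ρ) n).2, hs_prod]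
  have h₁ := hs_le_add f g hg hfg (n + 1)
  have h₂ := hs_le_add i p hp h (n + 1)
  linarith

lemma len_torOne_prod (n : ℕ) :
    len A (torOne A (ModuleCat.of A (N × E)) n) =
      len A (torOne A (ModuleCat.of A N) n) + len A (torOne A (ModuleCat.of A E) n) := by
  obtain ⟨r, π, hπ⟩ := Module.Finite.exists_fin' A N
  obtain ⟨s, ρ, hρ⟩ := Module.Finite.exists_fin' A E
  have hex : Function.Exact ((LinearMap.ker π).subtype.prodMap (LinearMap.ker ρ).subtype)
      (π.prodMap ρ) := by
    rintro ⟨a, b⟩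
    simp [Prod.ext_iff]
  rw [(len_torOne_eq (Function.Injective.prodMap (LinearMap.ker π).subtype_injective
      (LinearMap.ker ρ).subtype_injective) (Function.Surjective.prodMap hπ hρ) hex n).2,
    (len_torOne_eq (LinearMap.ker π).subtype_injective hπ
      (LinearMap.exact_subtype_ker_map π) n).2,
    (len_torOne_eq (LinearMap.ker ρ).subtype_injective hρ
      (LinearMap.exact_subtype_ker_map ρ) n).2, hs_prod, hs_prod, hs_prod]
  ring

/-- Subadditivity of `e^T` on short exact sequences. -/
theorem eT_le_add {i : N →ₗ[A] E} {p : E →ₗ[A] M} (hi : Function.Injective i)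
    (hp : Function.Surjective p) (h : Function.Exact i p) :
    eT A (ModuleCat.of A E) ≤ eT A (ModuleCat.of A N) + eT A (ModuleCat.of A M) := by
  refine le_of_tendsto_of_tendsto' (tendsto_eTSeq E) ((tendsto_eTSeq N).add (tendsto_eTSeq M))
    fun n => ?_
  rw [eTSeq_eq, eTSeq_eq, eTSeq_eq, ← mul_add]
  exact mul_le_mul_of_nonneg_left (len_torOne_le_add hi hp h n) (by positivity)

theorem eT_prod :
    eT A (ModuleCat.of A (N × E)) = eT A (ModuleCat.of A N) + eT A (ModuleCat.of A E) := by
  refine tendsto_nhds_unique (tendsto_eTSeq (N × E))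
    (((tendsto_eTSeq N).add (tendsto_eTSeq E)).congr fun n => ?_)
  rw [eTSeq_eq, eTSeq_eq, eTSeq_eq, ← mul_add, len_torOne_prod]

end TorOne

lemma finite_of_shortExact {A : Type u} [CommRing A]
    {S : ShortComplex (ModuleCat.{u} A)} (hS : S.ShortExact)
    [Module.Finite A S.X₁] [Module.Finite A S.X₃] : Module.Finite A S.X₂ :=
  Module.Finite.of_exact
    ((ShortComplex.ShortExact.moduleCat_exact_iff_function_exact S).1 hS.exact)
    hS.moduleCat_surjective_g

/-! ### Extensions of MCM modules -/

section Depth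

variable {A : Type u} [CommRing A] [IsLocalRing A]

lemma maximalIdeal_smul_lt_top (M : Type u) [AddCommGroup M] [Module A M] [Module.Finite A M]
    [Nontrivial M] : maximalIdeal A • (⊤ : Submodule A M) < ⊤ :=
  (Submodule.top_ne_ideal_smul_of_le_jacobson_annihilator
    (IsLocalRing.maximalIdeal_le_jacobson _)).symm.lt_top

lemma support_residue :
    Module.support A (ModuleCat.of A (A ⧸ maximalIdeal A)) =
      PrimeSpectrum.zeroLocus (maximalIdeal A) := by
  rw [Module.support_eq_zeroLocus, Ideal.annihilator_quotient]

variable [IsNoetherianRing A]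

/-- Maximal Cohen–Macaulay modules are characterized by the vanishing of `Extⁱ(A/𝔪, M)` for
`i < dim A`. -/
lemma isMCM_iff {d : ℕ} (hd : (d : WithBot ℕ∞) = ringKrullDim A) (M : ModuleCat.{u} A)
    [Module.Finite A M] :
    IsMCM A M ↔ ∀ i < d, Subsingleton (Ext.{u} (ModuleCat.of A (A ⧸ maximalIdeal A)) M i) := by
  rcases subsingleton_or_nontrivial M with hM | hM
  · refine ⟨fun _ i _ => ?_, fun _ => ⟨inferInstance, Or.inl hM⟩⟩
    refine subsingleton_of_forall_eq 0 fun x => ?_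
    rw [← x.comp_mk₀_id, (ModuleCat.isZero_of_subsingleton M).eq_of_src (𝟙 M) 0, Ext.mk₀_zero,
      Ext.comp_zero]
  · constructor
    · rintro ⟨-, h⟩
      obtain ⟨rs, hrs, hl, hreg⟩ := h.resolve_left (not_subsingleton M)
      have hl' : rs.length = d := by
        rw [← hd] at hl
        exact_mod_cast hl
      rw [← hl']
      exact ModuleCat.subsingleton_ext_of_exists_isRegular (maximalIdeal A) _
        support_residue.subset M (maximalIdeal_smul_lt_top M) rs hrs hreg
    · intro h
      obtain ⟨rs, hl, hrs, hreg⟩ := ModuleCat.exists_isRegular_of_exists_subsingleton_ext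
        (maximalIdeal A) d M (maximalIdeal_smul_lt_top M) _ support_residue h
      exact ⟨inferInstance, Or.inr ⟨rs, hrs, by rw [hl, hd], hreg⟩⟩

/-- In the long exact sequence of Ext(A/𝔪, −), the middle term vanishes wherever both neighbours do.
-/
lemma isMCM_of_shortExact {S : ShortComplex (ModuleCat.{u} A)} (hS : S.ShortExact)
    (h₁ : IsMCM A S.X₁) (h₃ : IsMCM A S.X₃) : IsMCM A S.X₂ := by
  have := h₁.1
  have := h₃.1
  have := finite_of_shortExact hS
  obtain ⟨d, hd⟩ : ∃ d : ℕ, (d : WithBot ℕ∞) = ringKrullDim A := by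
    obtain ⟨d, hd⟩ := ENat.ne_top_iff_exists.1 (Ideal.height_ne_top
      (IsLocalRing.maximalIdeal.isMaximal A).ne_top)
    exact ⟨d, by rw [← IsLocalRing.maximalIdeal_height_eq_ringKrullDim, ← hd]; rfl⟩
  rw [isMCM_iff hd] at h₁ h₃ ⊢
  intro i hi
  have := h₁ i hi
  have := h₃ i hi
  refine subsingleton_of_forall_eq 0 fun x => ?_
  obtain ⟨y, rfl⟩ := Ext.covariant_sequence_exact₂ _ hS x (Subsingleton.elim _ _)
  rw [Subsingleton.elim y 0, Ext.zero_comp]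

end Depth

/-! ### Behaviour of the defect under morphisms of extensions -/

section Comparison

variable {A : Type u} [CommRing A] [IsLocalRing A] [IsNoetherianRing A]
variable {N E M N' E' M' : ModuleCat.{u} A} [Module.Finite A E] [Module.Finite A E']

/-- Pushing an extension out along `f : N ⟶ N'` does not increase the defect of `e^T`. -/
lemma eT_add_le_of_pushout [Module.Finite A N] [Module.Finite A N'] {i : N ⟶ E} {p : E ⟶ M} {w : i ≫ p = 0}
    (hS : (ShortComplex.mk i p w).ShortExact) {i' : N' ⟶ E'} {p' : E' ⟶ M} {w' : i' ≫ p' = 0}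
    (hS' : (ShortComplex.mk i' p' w').ShortExact) (f : N ⟶ N') (φ : E ⟶ E')
    (h₁ : i ≫ φ = f ≫ i') (h₂ : φ ≫ p' = p) :
    eT A N' + eT A E ≤ eT A N + eT A E' := by
  have hi : Function.Injective i := hS.moduleCat_injective_f
  have hp : Function.Surjective p := hS.moduleCat_surjective_g
  have hex : Function.Exact i p :=
    (ShortComplex.ShortExact.moduleCat_exact_iff_function_exact _).1 hS.exact
  have hi' : Function.Injective i' := hS'.moduleCat_injective_f
  have hex' : Function.Exact i' p' :=
    (ShortComplex.ShortExact.moduleCat_exact_iff_function_exact _).1 hS'.exact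
  have e₁ : ∀ x, φ (i x) = i' (f x) := fun x => ConcreteCategory.congr_hom h₁ x
  have e₂ : ∀ x, p' (φ x) = p x := fun x => ConcreteCategory.congr_hom h₂ x
  -- Subadditivity for 0 → N → N' ⊕ E → E' → 0.
  have h := eT_le_add (A := A) (i := f.hom.prod i.hom)
    (p := i'.hom ∘ₗ LinearMap.fst A N' E - φ.hom ∘ₗ LinearMap.snd A N' E)
    (fun x y hxy => hi (congrArg Prod.snd hxy))
    (fun y => by
      obtain ⟨e, he⟩ := hp (p' y)
      obtain ⟨x, hx⟩ := (hex' (y + φ (-e))).1 (by rw [map_add, e₂, map_neg, he, add_neg_cancel])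
      refine ⟨(x, -e), ?_⟩
      change i' x - φ (-e) = y
      rw [hx, add_sub_cancel_right])
    (fun y => by
      obtain ⟨a, b⟩ := y
      constructor
      · intro hab
        have hab' : i' a = φ b := sub_eq_zero.1 hab
        obtain ⟨x, rfl⟩ := (hex b).1 (by rw [← e₂, ← hab', hex'.apply_apply_eq_zero])
        refine ⟨x, Prod.ext (hi' ?_) rfl⟩
        rw [hab', e₁]
        rfl
      · rintro ⟨x, hx⟩
        rw [← hx]
        change i' (f x) - φ (i x) = 0
        rw [e₁, sub_self])
  rw [eT_prod] at h
  exact h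

/-- Pulling an extension back along `h : M' ⟶ M` does not increase the defect of `e^T`. -/
lemma eT_add_le_of_pullback [Module.Finite A M] [Module.Finite A M'] {i : N ⟶ E} {p : E ⟶ M} {w : i ≫ p = 0}
    (hS : (ShortComplex.mk i p w).ShortExact) {i' : N ⟶ E'} {p' : E' ⟶ M'} {w' : i' ≫ p' = 0}
    (hS' : (ShortComplex.mk i' p' w').ShortExact) (h : M' ⟶ M) (φ : E' ⟶ E)
    (h₁ : i' ≫ φ = i) (h₂ : φ ≫ p = p' ≫ h) :
    eT A E + eT A M' ≤ eT A E' + eT A M := by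
  have hi : Function.Injective i := hS.moduleCat_injective_f
  have hp : Function.Surjective p := hS.moduleCat_surjective_g
  have hex : Function.Exact i p :=
    (ShortComplex.ShortExact.moduleCat_exact_iff_function_exact _).1 hS.exact
  have hp' : Function.Surjective p' := hS'.moduleCat_surjective_g
  have hex' : Function.Exact i' p' :=
    (ShortComplex.ShortExact.moduleCat_exact_iff_function_exact _).1 hS'.exact
  have e₁ : ∀ x, φ (i' x) = i x := fun x => ConcreteCategory.congr_hom h₁ x
  have e₂ : ∀ x, p (φ x) = h (p' x) := fun x => ConcreteCategory.congr_hom h₂ x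
  -- Subadditivity for 0 → E' → E ⊕ M' → M → 0.
  have key := eT_le_add (A := A) (i := φ.hom.prod p'.hom)
    (p := p.hom ∘ₗ LinearMap.fst A E M' - h.hom ∘ₗ LinearMap.snd A E M')
    ((injective_iff_map_eq_zero _).2 fun x hx => by
      have hx₁ : φ x = 0 := congrArg Prod.fst hx
      have hx₂ : p' x = 0 := congrArg Prod.snd hx
      obtain ⟨y, rfl⟩ := (hex' x).1 hx₂
      rw [e₁] at hx₁
      rw [hi (hx₁.trans (map_zero i.hom).symm)]
      exact map_zero i'.hom)
    (fun y => by
      obtain ⟨e, he⟩ := hp y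
      refine ⟨(e, 0), ?_⟩
      change p e - h 0 = y
      rw [map_zero, sub_zero, he])
    (fun y => by
      obtain ⟨a, b⟩ := y
      constructor
      · intro hab
        have hab' : p a = h b := sub_eq_zero.1 hab
        obtain ⟨e, rfl⟩ := hp' b
        obtain ⟨x, hx⟩ := (hex (a - φ e)).1 (by rw [map_sub, hab', e₂, sub_self])
        refine ⟨i' x + e, Prod.ext ?_ ?_⟩
        · change φ (i' x + e) = a
          rw [map_add, e₁, hx, sub_add_cancel]
        · change p' (i' x + e) = p' e
          rw [map_add, hex'.apply_apply_eq_zero, zero_add]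
      · rintro ⟨x, hx⟩
        rw [← hx]
        change p (φ x) - h (p' x) = 0
        rw [e₂, sub_self])
  rw [eT_prod] at key
  exact key

variable [Module.Finite A M]

lemma eTDefect_nonneg [Module.Finite A N] {i : N ⟶ E} {p : E ⟶ M} {w : i ≫ p = 0}
    (hS : (ShortComplex.mk i p w).ShortExact) : 0 ≤ eTDefect A (ShortComplex.mk i p w) := by
  have h : eT A E ≤ eT A N + eT A M := eT_le_add (i := i.hom) (p := p.hom)
    hS.moduleCat_injective_f hS.moduleCat_surjective_g
    ((ShortComplex.ShortExact.moduleCat_exact_iff_function_exact _).1 hS.exact)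
  dsimp only [eTDefect]
  linarith

/-- The value `e^T(E)` only depends on the class of the extension `E`. -/
lemma eT_le_of_extClass_eq {i : N ⟶ E} {p : E ⟶ M} {w : i ≫ p = 0}
    (hS : (ShortComplex.mk i p w).ShortExact) {i' : N ⟶ E'} {p' : E' ⟶ M} {w' : i' ≫ p' = 0}
    (hS' : (ShortComplex.mk i' p' w').ShortExact)
    (h : (hS.extClass : Ext.{u} M N 1) = hS'.extClass) : eT A E' ≤ eT A E := by
  -- The common class dies under `i'`, so `i'` extends to `φ : E ⟶ E'`, inducing some `ψ` on `M`.
  -- The pullback inequality holds for any such `ψ`, and the terms e^T(M) cancel; `ψ` need not be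
  -- the identity.
  have h0 : hS.extClass.comp (Ext.mk₀ i') (add_zero 1) = 0 := by
    rw [h]
    exact hS'.extClass_comp
  obtain ⟨x, hx⟩ := Ext.contravariant_sequence_exact₁ hS _ (Ext.mk₀ i') (add_zero 1) h0
  obtain ⟨φ, rfl⟩ := Ext.mk₀_bijective _ _ |>.2 x
  rw [Ext.mk₀_comp_mk₀] at hx
  have hφ : i ≫ φ = i' := (Ext.mk₀_bijective _ _).1 hx
  have : Epi p := hS.epi_g
  obtain ⟨ψ, hψ⟩ : ∃ ψ : M ⟶ M, p ≫ ψ = φ ≫ p' :=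
    ⟨hS.exact.desc (φ ≫ p') (by rw [← Category.assoc, hφ, w']), hS.exact.g_desc _ _⟩
  have := eT_add_le_of_pullback hS' hS ψ φ hφ hψ.symm
  linarith

end Comparison

/-! ### Pushouts and pullbacks of extensions -/

section Constructions

variable {A : Type u} [CommRing A]

/-- The pushout of an extension along `f : N ⟶ N'`. -/
lemma exists_pushout {N E M N' : ModuleCat.{u} A} {i : N ⟶ E} {p : E ⟶ M} {w : i ≫ p = 0}
    (hS : (ShortComplex.mk i p w).ShortExact) (f : N ⟶ N') :
    ∃ (E' : ModuleCat.{u} A) (i' : N' ⟶ E') (p' : E' ⟶ M) (w' : i' ≫ p' = 0)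
      (_ : (ShortComplex.mk i' p' w').ShortExact) (φ : E ⟶ E'),
      i ≫ φ = f ≫ i' ∧ φ ≫ p' = p := by
  have hi : Function.Injective i := hS.moduleCat_injective_f
  have hp : Function.Surjective p := hS.moduleCat_surjective_g
  have hex : Function.Exact i p :=
    (ShortComplex.ShortExact.moduleCat_exact_iff_function_exact _).1 hS.exact
  let R : Submodule A (E × N') := LinearMap.range (i.hom.prod (-f.hom))
  let i' : N' →ₗ[A] (E × N') ⧸ R := R.mkQ ∘ₗ LinearMap.inr A E N'
  let p' : ((E × N') ⧸ R) →ₗ[A] M := R.liftQ (p.hom ∘ₗ LinearMap.fst A E N') (by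
    rintro _ ⟨x, rfl⟩
    exact hex.apply_apply_eq_zero x)
  let φ : E →ₗ[A] (E × N') ⧸ R := R.mkQ ∘ₗ LinearMap.inl A E N'
  have hi' : Function.Injective i' := by
    refine (injective_iff_map_eq_zero _).2 fun y hy => ?_
    obtain ⟨x, hx⟩ := (Submodule.Quotient.mk_eq_zero _).1 hy
    have hx₁ : i x = 0 := congrArg Prod.fst hx
    have hx₂ : -f x = y := congrArg Prod.snd hx
    rw [hi (hx₁.trans (map_zero i.hom).symm), map_zero, neg_zero] at hx₂
    exact hx₂.symm
  have hp' : Function.Surjective p' := fun y => by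
    obtain ⟨e, rfl⟩ := hp y
    exact ⟨φ e, rfl⟩
  have hex' : Function.Exact i' p' := by
    intro y
    obtain ⟨⟨e, n⟩, rfl⟩ := R.mkQ_surjective y
    constructor
    · intro he
      have he' : p e = 0 := he
      obtain ⟨x, rfl⟩ := (hex e).1 he'
      refine ⟨n + f x, (Submodule.Quotient.eq _).2 ⟨-x, ?_⟩⟩
      refine Prod.ext ?_ ?_
      · change i (-x) = 0 - i x
        simp
      · change -f (-x) = n + f x - n
        simp
    · rintro ⟨n', hn'⟩
      rw [← hn']
      exact map_zero p.hom
  refine ⟨ModuleCat.of A ((E × N') ⧸ R), ModuleCat.ofHom i', ModuleCat.ofHom p', ?_, ?_,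
    ModuleCat.ofHom φ, ?_, ?_⟩
  · ext x
    exact hex'.apply_apply_eq_zero x
  · exact ModuleCat.shortComplex_shortExact _ hex' hi' hp'
  · ext x
    refine (Submodule.Quotient.eq _).2 ⟨x, Prod.ext ?_ ?_⟩
    · change i x = i x - 0
      rw [sub_zero]
    · change -f x = 0 - f x
      rw [zero_sub]
  · ext x
    rfl

/-- The pullback of an extension along `h : M' ⟶ M`. -/
lemma exists_pullback {N E M M' : ModuleCat.{u} A} {i : N ⟶ E} {p : E ⟶ M} {w : i ≫ p = 0}
    (hS : (ShortComplex.mk i p w).ShortExact) (h : M' ⟶ M) :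
    ∃ (E' : ModuleCat.{u} A) (i' : N ⟶ E') (p' : E' ⟶ M') (w' : i' ≫ p' = 0)
      (_ : (ShortComplex.mk i' p' w').ShortExact) (φ : E' ⟶ E),
      i' ≫ φ = i ∧ φ ≫ p = p' ≫ h := by
  have hi : Function.Injective i := hS.moduleCat_injective_f
  have hp : Function.Surjective p := hS.moduleCat_surjective_g
  have hex : Function.Exact i p :=
    (ShortComplex.ShortExact.moduleCat_exact_iff_function_exact _).1 hS.exact
  let R : Submodule A (E × M') := LinearMap.eqLocus (p.hom ∘ₗ LinearMap.fst A E M')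
    (h.hom ∘ₗ LinearMap.snd A E M')
  let i' : N →ₗ[A] R := (LinearMap.inl A E M' ∘ₗ i.hom).codRestrict R fun x => by
    change p (i x) = h 0
    rw [hex.apply_apply_eq_zero, map_zero]
  let p' : R →ₗ[A] M' := LinearMap.snd A E M' ∘ₗ R.subtype
  let φ : R →ₗ[A] E := LinearMap.fst A E M' ∘ₗ R.subtype
  have hi' : Function.Injective i' := fun x y hxy => hi (congrArg (fun z => z.1.1) hxy)
  have hp' : Function.Surjective p' := fun y => by
    obtain ⟨e, he⟩ := hp (h y)
    exact ⟨⟨(e, y), he⟩, rfl⟩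
  have hex' : Function.Exact i' p' := by
    rintro ⟨⟨e, m⟩, hem⟩
    constructor
    · rintro rfl
      have he : p e = h 0 := hem
      obtain ⟨x, rfl⟩ := (hex e).1 (he.trans (map_zero h.hom))
      exact ⟨x, rfl⟩
    · rintro ⟨x, hx⟩
      rw [← hx]
      rfl
  refine ⟨ModuleCat.of A R, ModuleCat.ofHom i', ModuleCat.ofHom p', ?_, ?_,
    ModuleCat.ofHom φ, ?_, ?_⟩
  · ext x
    exact hex'.apply_apply_eq_zero x
  · exact ModuleCat.shortComplex_shortExact _ hex' hi' hp'
  · ext x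
    rfl
  · ext x
    exact x.2

end Constructions

/-! ### The subfunctor `T_A` -/

section Subfunctor

variable {A : Type u} [CommRing A] [IsLocalRing A] [IsNoetherianRing A]
variable {N M N' M' : ModuleCat.{u} A} [Module.Finite A N] [Module.Finite A M]

lemma extClass_mem_tSplit_iff {S : ShortComplex (ModuleCat.{u} A)} (hS : S.ShortExact)
    [Module.Finite A S.X₁] [Module.Finite A S.X₃] :
    hS.extClass ∈ tSplit A S.X₃ S.X₁ ↔ eTDefect A S = 0 := by
  refine ⟨?_, fun h => ⟨S.X₂, S.f, S.g, S.zero, hS, rfl, h⟩⟩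
  rintro ⟨E, i, p, w, hE, hc, h0⟩
  have : Module.Finite A S.X₂ := finite_of_shortExact hS
  have : Module.Finite A E := finite_of_shortExact hE
  have h₁ : eT A S.X₂ ≤ eT A E := eT_le_of_extClass_eq hE hS hc
  have h₂ : eT A E ≤ eT A S.X₂ := eT_le_of_extClass_eq hS hE hc.symm
  rw [← h0]
  simp only [eTDefect]
  linarith

lemma zero_mem_tSplit : (0 : Ext.{u} M N 1) ∈ tSplit A M N := by
  have hS : (ShortComplex.mk (ModuleCat.ofHom (LinearMap.inl A N M))
      (ModuleCat.ofHom (LinearMap.snd A N M)) (by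
        rw [← ModuleCat.ofHom_comp, LinearMap.snd_comp_inl]
        rfl)).ShortExact :=
    ModuleCat.shortComplex_shortExact _
      (fun x => by
        obtain ⟨a, b⟩ := x
        constructor
        · rintro rfl
          exact ⟨a, rfl⟩
        · rintro ⟨y, hy⟩
          rw [← hy]
          rfl)
      (LinearMap.inl_injective (R := A)) (LinearMap.snd_surjective (R := A))
  refine ⟨_, _, _, _, hS, ?_, ?_⟩
  -- The class equals its pullback along inr followed by snd, which is the identity of `M`; the
  -- pullback along snd already vanishes.
  · have h := hS.comp_extClass
    have h' : (Ext.mk₀ (ModuleCat.ofHom (LinearMap.inr A N M))).comp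
        ((Ext.mk₀ (ModuleCat.ofHom (LinearMap.snd A N M))).comp hS.extClass (zero_add 1))
        (zero_add 1) = 0 := by
      rw [h, Ext.comp_zero]
    rw [Ext.mk₀_comp_mk₀_assoc] at h'
    exact (Ext.mk₀_id_comp _).symm.trans h'
  · have h : eT A (ModuleCat.of A (N × M)) = eT A N + eT A M := eT_prod
    dsimp only [eTDefect]
    rw [h, add_comm, sub_self]

lemma comp_mk₀_mem_tSplit [Module.Finite A N'] {α : Ext.{u} M N 1} (hα : α ∈ tSplit A M N)
    (f : N ⟶ N') : α.comp (Ext.mk₀ f) (add_zero 1) ∈ tSplit A M N' := by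
  obtain ⟨E, i, p, w, hS, rfl, h0⟩ := hα
  obtain ⟨E', i', p', w', hS', φ, h₁, h₂⟩ := exists_pushout hS f
  have : Module.Finite A E := finite_of_shortExact hS
  have : Module.Finite A E' := finite_of_shortExact hS'
  refine ⟨E', i', p', w', hS', ?_, le_antisymm ?_ (eTDefect_nonneg hS')⟩
  · have := ShortComplex.ShortExact.extClass_naturality hS hS'
      { τ₁ := f, τ₂ := φ, τ₃ := 𝟙 M, comm₁₂ := h₁.symm, comm₂₃ := by simpa using h₂ }
    exact ((Ext.mk₀_id_comp _).symm.trans this.symm)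
  · have := eT_add_le_of_pushout hS hS' f φ h₁ h₂
    dsimp only [eTDefect] at h0 ⊢
    linarith

lemma mk₀_comp_mem_tSplit [Module.Finite A M'] {α : Ext.{u} M N 1} (hα : α ∈ tSplit A M N)
    (g : M' ⟶ M) : (Ext.mk₀ g).comp α (zero_add 1) ∈ tSplit A M' N := by
  obtain ⟨E, i, p, w, hS, rfl, h0⟩ := hα
  obtain ⟨E', i', p', w', hS', φ, h₁, h₂⟩ := exists_pullback hS g
  have : Module.Finite A E := finite_of_shortExact hS
  have : Module.Finite A E' := finite_of_shortExact hS'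
  refine ⟨E', i', p', w', hS', ?_, le_antisymm ?_ (eTDefect_nonneg hS')⟩
  · have := ShortComplex.ShortExact.extClass_naturality hS' hS
      { τ₁ := 𝟙 N, τ₂ := φ, τ₃ := g, comm₁₂ := by simpa using h₁.symm, comm₂₃ := h₂ }
    exact ((Ext.comp_mk₀_id _).symm.trans this)
  · have := eT_add_le_of_pullback hS hS' g φ h₁ h₂
    dsimp only [eTDefect] at h0 ⊢
    linarith

/-- Scaling a class by `r` is pushing it out along `r • 𝟙 N`. -/
lemma smul_mem_tSplit {α : Ext.{u} M N 1} (hα : α ∈ tSplit A M N) (r : A) :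
    r • α ∈ tSplit A M N := by
  have := comp_mk₀_mem_tSplit hα (r • 𝟙 N)
  rwa [Ext.mk₀_smul, Ext.comp_smul, Ext.comp_mk₀_id] at this

lemma add_mem_tSplit {α β : Ext.{u} M N 1} (hα : α ∈ tSplit A M N) (hβ : β ∈ tSplit A M N) :
    α + β ∈ tSplit A M N := by
  obtain ⟨E, i, p, w, hS, rfl, h0⟩ := hα
  obtain ⟨E', i', p', w', hS', rfl, h0'⟩ := hβ
  have : Module.Finite A E := finite_of_shortExact hS
  have : Module.Finite A E' := finite_of_shortExact hS'
  have hi : Function.Injective i := hS.moduleCat_injective_f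
  have hp : Function.Surjective p := hS.moduleCat_surjective_g
  have hex : Function.Exact i p :=
    (ShortComplex.ShortExact.moduleCat_exact_iff_function_exact _).1 hS.exact
  have hi' : Function.Injective i' := hS'.moduleCat_injective_f
  have hp' : Function.Surjective p' := hS'.moduleCat_surjective_g
  have hex' : Function.Exact i' p' :=
    (ShortComplex.ShortExact.moduleCat_exact_iff_function_exact _).1 hS'.exact
  -- The kernel of δ is the fibre product E ×_M E', an extension of `M` by `N × N` whose pushouts
  -- along the two projections are the given extensions.
  let δ : E × E' →ₗ[A] M := p.hom ∘ₗ LinearMap.fst A E E' - p'.hom ∘ₗ LinearMap.snd A E E'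
  have hδ : ∀ a b, δ (a, b) = p a - p' b := fun _ _ => rfl
  let P := LinearMap.ker δ
  let j : (N × N) →ₗ[A] P := (i.hom.prodMap i'.hom).codRestrict P fun x => by
    change p (i x.1) - p' (i' x.2) = 0
    rw [hex.apply_apply_eq_zero, hex'.apply_apply_eq_zero, sub_self]
  let q : P →ₗ[A] M := p.hom ∘ₗ LinearMap.fst A E E' ∘ₗ P.subtype
  have hq : ∀ x : P, p x.1.1 = p' x.1.2 := fun x => sub_eq_zero.1 x.2
  have hjq : Function.Exact j q := by
    intro x
    constructor
    · intro hx
      have hx₁ : p x.1.1 = 0 := hx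
      obtain ⟨a, ha⟩ := (hex _).1 hx₁
      obtain ⟨b, hb⟩ := (hex' _).1 ((hq x).symm.trans hx₁)
      exact ⟨(a, b), Subtype.ext (Prod.ext ha hb)⟩
    · rintro ⟨y, rfl⟩
      exact hex.apply_apply_eq_zero y.1
  have hσ : (ShortComplex.mk (ModuleCat.ofHom j) (ModuleCat.ofHom q)
      (ModuleCat.hom_ext (LinearMap.ext hjq.apply_apply_eq_zero))).ShortExact :=
    ModuleCat.shortComplex_shortExact _ hjq
      (fun x y hxy => Prod.ext (hi (congrArg (fun z => z.1.1) hxy))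
        (hi' (congrArg (fun z => z.1.2) hxy)))
      (fun y => by
        obtain ⟨a, ha⟩ := hp y
        obtain ⟨b, hb⟩ := hp' y
        exact ⟨⟨(a, b), by rw [LinearMap.mem_ker, hδ, ha, hb, sub_self]⟩, ha⟩)
  have hσT : hσ.extClass ∈ tSplit A M (ModuleCat.of A (N × N)) := by
    refine ⟨_, _, _, _, hσ, rfl, le_antisymm ?_ (eTDefect_nonneg hσ)⟩
    -- Subadditivity for 0 → P → E ⊕ E' → M → 0 bounds the defect of `P` by the sum of the two given
    -- defects, which is 0.
    have h₁ := eT_le_add (A := A) (i := P.subtype) (p := δ) P.subtype_injective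
      (fun y => by
        obtain ⟨a, ha⟩ := hp y
        exact ⟨(a, 0), by rw [hδ, ha, map_zero, sub_zero]⟩)
      (LinearMap.exact_subtype_ker_map δ)
    rw [eT_prod] at h₁
    have h₂ : eT A (ModuleCat.of A (N × N)) = eT A N + eT A N := eT_prod
    dsimp only [eTDefect] at h0 h0' ⊢
    rw [h₂]
    have h₃ : eT A E + eT A E' ≤ eT A (ModuleCat.of A P) + eT A M := h₁
    linarith
  have e₁ := ShortComplex.ShortExact.extClass_naturality hσ hS
    { τ₁ := ModuleCat.ofHom (LinearMap.fst A N N)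
      τ₂ := ModuleCat.ofHom (LinearMap.fst A E E' ∘ₗ P.subtype)
      τ₃ := 𝟙 M
      comm₁₂ := rfl
      comm₂₃ := rfl }
  have e₂ := ShortComplex.ShortExact.extClass_naturality hσ hS'
    { τ₁ := ModuleCat.ofHom (LinearMap.snd A N N)
      τ₂ := ModuleCat.ofHom (LinearMap.snd A E E' ∘ₗ P.subtype)
      τ₃ := 𝟙 M
      comm₁₂ := rfl
      comm₂₃ := by
        ext x
        exact (hq x).symm }
  -- The map fst + snd is addition N × N → N, so this pushout is the Baer sum.
  have := comp_mk₀_mem_tSplit hσT (ModuleCat.ofHom (LinearMap.fst A N N) +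
    ModuleCat.ofHom (LinearMap.snd A N N))
  rw [Ext.mk₀_add, Ext.comp_add] at this
  convert this using 1
  exact congrArg₂ (· + ·) ((Ext.mk₀_id_comp _).symm.trans e₁.symm)
    ((Ext.mk₀_id_comp _).symm.trans e₂.symm)

/-- `T_A(M, N)` as a submodule of `Ext¹(M, N)`. -/
def tSplitSubmodule (M N : ModuleCat.{u} A) [Module.Finite A M] [Module.Finite A N] :
    Submodule A (Ext.{u} M N 1) where
  carrier := tSplit A M N
  zero_mem' := zero_mem_tSplit
  add_mem' := add_mem_tSplit
  smul_mem' r _ hα := smul_mem_tSplit hα r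

instance (M : CM A) : Module.Finite A M.obj := M.property.1

variable (A) in
/-- The functor `T_A`. -/
def tSplitFunctor : (CM A)ᵒᵖ ⥤ CM A ⥤ FGModuleCat.{u} A where
  obj M :=
    { obj N := ⟨ModuleCat.of A (tSplitSubmodule M.unop.obj N.obj), by
        have := finite_ext A M.unop N
        change Module.Finite A (tSplitSubmodule M.unop.obj N.obj)
        infer_instance⟩
      map f := ObjectProperty.homMk (ModuleCat.ofHom
        (((Ext.mk₀ f.hom).postcompOfLinear A M.unop.obj (add_zero 1)).restrict
          fun _ hα => comp_mk₀_mem_tSplit hα f.hom))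
      map_id N := by
        exact FGModuleCat.hom_ext (LinearMap.ext fun α => Subtype.ext (Ext.comp_mk₀_id α.1))
      map_comp f g := by
        refine FGModuleCat.hom_ext (LinearMap.ext fun α => Subtype.ext ?_)
        change α.1.comp (Ext.mk₀ (f.hom ≫ g.hom)) (add_zero 1) =
          (α.1.comp (Ext.mk₀ f.hom) (add_zero 1)).comp (Ext.mk₀ g.hom) (add_zero 1)
        simp [← Ext.mk₀_comp_mk₀, Ext.comp_assoc_of_second_deg_zero] }
  map g :=
    { app N := ObjectProperty.homMk (ModuleCat.ofHom
        (((Ext.mk₀ g.unop.hom).precompOfLinear A N.obj (zero_add 1)).restrict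
          fun _ hα => mk₀_comp_mem_tSplit hα g.unop.hom))
      naturality N N' f := by
        refine FGModuleCat.hom_ext (LinearMap.ext fun α => Subtype.ext ?_)
        change (Ext.mk₀ g.unop.hom).comp (α.1.comp (Ext.mk₀ f.hom) (add_zero 1)) (zero_add 1) =
          ((Ext.mk₀ g.unop.hom).comp α.1 (zero_add 1)).comp (Ext.mk₀ f.hom) (add_zero 1)
        simp [Ext.comp_assoc_of_third_deg_zero] }
  map_id M := by
    ext N : 2
    exact FGModuleCat.hom_ext (LinearMap.ext fun α => Subtype.ext (Ext.mk₀_id_comp α.1))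
  map_comp g h := by
    ext N : 2
    refine FGModuleCat.hom_ext (LinearMap.ext fun α => Subtype.ext ?_)
    change (Ext.mk₀ (h.unop.hom ≫ g.unop.hom)).comp α.1 (zero_add 1) =
      (Ext.mk₀ h.unop.hom).comp ((Ext.mk₀ g.unop.hom).comp α.1 (zero_add 1)) (zero_add 1)
    simp

variable (A) in
/-- The inclusion of `T_A` into `Ext¹`. -/
def tSplitInclusion : tSplitFunctor A ⟶ extOne A where
  app M :=
    { app N := ObjectProperty.homMk
        (ModuleCat.ofHom (tSplitSubmodule M.unop.obj N.obj).subtype)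
      naturality _ _ _ := rfl }
  naturality _ _ _ := rfl

end Subfunctor

end TorSplit

end

open TorSplit in
theorem theorem3 (A : Type u) [CommRing A] [IsCohenMacaulayLocal A] :
    -- the lengths are finite and the limit `e^T(M)` exists
    (∀ M : CM A, (∀ n, Module.length A (torOne A M.obj n) ≠ ⊤) ∧
      Filter.Tendsto (eTSeq A M.obj) Filter.atTop (nhds (eT A M.obj))) ∧
    -- `T`-splitness depends only on the class of an extension, and extensions stay in `CM(A)`
    (∀ (S : ShortComplex (ModuleCat.{u} A)) (hS : S.ShortExact),
      IsMCM A S.X₁ → IsMCM A S.X₃ →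
        IsMCM A S.X₂ ∧ (hS.extClass ∈ tSplit A S.X₃ S.X₁ ↔ eTDefect A S = 0)) ∧
    -- `T_A(M, N)` is a submodule of `Ext¹(M, N)`
    (∀ M N : CM A, ∃ P : Submodule A (Ext.{u} M.obj N.obj 1),
      (P : Set (Ext.{u} M.obj N.obj 1)) = tSplit A M.obj N.obj) ∧
    -- `T_A` is a subfunctor of `Ext¹`
    (∃ (T : (CM A)ᵒᵖ ⥤ CM A ⥤ FGModuleCat.{u} A) (ι : T ⟶ extOne A),
      ∀ M N : CM A,
        Function.Injective ((ι.app (Opposite.op M)).app N).hom.hom ∧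
        Set.range ((ι.app (Opposite.op M)).app N).hom.hom = tSplit A M.obj N.obj) := by
  refine ⟨fun M => ⟨length_torOne_ne_top M.obj, tendsto_eTSeq M.obj⟩, fun S hS h₁ h₃ => ?_,
    fun M N => ⟨tSplitSubmodule M.obj N.obj, rfl⟩, tSplitFunctor A, tSplitInclusion A,
    fun M N => ⟨(tSplitSubmodule M.obj N.obj).subtype_injective, Subtype.range_coe⟩⟩
  have := h₁.1
  have := h₃.1
  exact ⟨isMCM_of_shortExact hS h₁ h₃, extClass_mem_tSplit_iff hS⟩
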